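/- Let $\mathbb T$ be the unit circle with normalised Lebesgue measure $m$, and let $\mathcal M^+$ be the set of measurable functions $\mathbb T\to[0,\infty]$. A Banach function norm is a map $\rho:\mathcal M^+\to[0,\infty]$ such that for all $f,g,f_k\in\mathcal M^+$ and all constants $a\ge 0$: (A1) $\rho(f)=0\Leftrightarrow f=0$ a.e., $\rho(af)=a\rho(f)$, $\rho(f+g)\le\rho(f)+\rho(g)$; (A2) $0\le g\le f$ a.e. implies $\rho(g)\le\rho(f)$; (A3) $0\le f_k\uparrow f$ a.e. implies $\rho(f_k)\uparrow\rho(f)$; (A4) $\rho(1)<\infty$; (A5) $\int_{\mathbb T}f\,dm\le C\rho(f)$ with a constant $C\in(0,\infty)$ independent of $f$. The Banach function space $X$ given by $\rho$ consists of the measurable $f:\mathbb T\to\mathbb C$ (modulo equality a.e.) with $\|f\|_X:=\rho(|f|)<\infty$; its associate space $X'$ is given in the same way by $\rho'(g)=\sup\{\int_{\mathbb T}fg\,dm: f\in\mathcal M^+,\ \rho(f)\le 1\}$. A weight is a measurable $w:\mathbb T\to[0,\infty]$ with $0<w<\infty$ a.e.; $X(w)$ is the space of measurable $f:\mathbb T\to\mathbb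 C$ with $fw\in X$, normed by $\|f\|_{X(w)}=\|fw\|_X$. Let $\widehat f(k)$, $k\in\mathbb Z$, denote the Fourier coefficients of $f\in L^1$. If $w\in X$ and $1/w\in X'$ (so that $X(w)\subset L^1$), put $H[X(w)]=\{f\in X(w):\widehat f(k)=0 \text{ for all } k<0\}$, with the norm of $X(w)$, and $H[X]=H[X(1)]$; $H^\infty$ is defined in the same way from $L^\infty$. For $f\in L^1$ and a.e. $t\in\mathbb T$ let $(Pf)(t)=\frac12\big(f(t)+\frac1{\pi i}\,\mathrm{p.v.}\!\int_{\mathbb T}\frac{f(\tau)}{\tau-t}\,d\tau\big)$. For $a\in L^\infty$ the Toeplitz operator with symbol $a$ is $T(a)f=P(af)$, and $\mathbf e_k(z)=z^k$. The essential norm of a bounded operator $A$ on a normed space $E$ is $\|A\|_{\mathcal B(E),\mathrm e}=\inf\{\|A-K\|_{\mathcal B(E)}: K \text{ a compact linear operator on } E\}$. **Lemma 3.3.** Let $X$ be a Banach function space with associate space $X'$, and let $w$ be a weight with $w\in X$ and $1/w\in X'$. If $n\in\mathbb N$ and $h\in H^\infty$, then $T(\mathbf e_{-n}h)$ is a well-defined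 bounded operator on $H[X(w)]$ and on $H[X]$, and $$\|T(\mathbf e_{-n}h)\|_{\mathcal B(H[X(w)]),\mathrm e}=\|T(\mathbf e_{-n}h)\|_{\mathcal B(H[X]),\mathrm e}.$$ (It is not assumed that $P$ is bounded on $X$ or on $X(w)$.) -/

import Mathlib

open MeasureTheory Filter Topology
open scoped ENNReal NNReal

/-- The unit circle `𝕋`, parametrised by the angle `θ ∈ ℝ/2πℤ`. -/
abbrev UCircle : Type := AddCircle (2 * Real.pi)

instance fact_zero_lt_two_mul_pi : Fact (0 < 2 * Real.pi) := ⟨Real.two_pi_pos⟩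

/-- The normalised Lebesgue measure `m` on the unit circle, `m(𝕋) = 1`. -/
noncomputable abbrev circleMeasure : Measure UCircle := AddCircle.haarAddCircle

/-- The point `e^{iθ}` of the complex plane that has angle `θ`. -/
noncomputable def circlePt (θ : UCircle) : ℂ := (AddCircle.toCircle θ : ℂ)

/-- A Banach function norm `ρ : M⁺ → [0,∞]` on the unit circle, `M⁺` being the (Lebesgue)
measurable functions with values in `[0,∞]`. The values of `ρ` at non-measurable functions are
irrelevant. -/
structure BanachFunctionNorm where
  /-- the underlying map -/
  toFun : (UCircle → ℝ≥0∞) → ℝ≥0∞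
  eq_zero_iff : ∀ f, AEMeasurable f circleMeasure → (toFun f = 0 ↔ f =ᵐ[circleMeasure] 0)
  smul : ∀ (a : ℝ≥0) (f), AEMeasurable f circleMeasure →
    toFun (fun t => (a : ℝ≥0∞) * f t) = (a : ℝ≥0∞) * toFun f
  add_le : ∀ f g, AEMeasurable f circleMeasure → AEMeasurable g circleMeasure →
    toFun (fun t => f t + g t) ≤ toFun f + toFun g
  /-- the lattice property -/
  mono : ∀ f g, AEMeasurable f circleMeasure → AEMeasurable g circleMeasure →
    g ≤ᵐ[circleMeasure] f → toFun g ≤ toFun f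
  /-- the Fatou property (that `n ↦ ρ (fₙ)` increases is contained in `mono`) -/
  fatou : ∀ (f : ℕ → UCircle → ℝ≥0∞) (g : UCircle → ℝ≥0∞),
    (∀ n, AEMeasurable (f n) circleMeasure) → AEMeasurable g circleMeasure →
    (∀ᵐ t ∂circleMeasure, Monotone (fun n => f n t) ∧
      Tendsto (fun n => f n t) atTop (𝓝 (g t))) →
    Tendsto (fun n => toFun (f n)) atTop (𝓝 (toFun g))
  one_lt_top : toFun (fun _ => 1) < ∞
  lintegral_le : ∃ C : ℝ≥0, 0 < C ∧ ∀ f, AEMeasurable f circleMeasure →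
    ∫⁻ t, f t ∂circleMeasure ≤ C * toFun f

/-- The associate norm `ρ'(g) = sup {∫ f g dm : f ∈ M⁺, ρ(f) ≤ 1}`. -/
noncomputable def BanachFunctionNorm.associate (ρ : BanachFunctionNorm)
    (g : UCircle → ℝ≥0∞) : ℝ≥0∞ :=
  ⨆ (f : UCircle → ℝ≥0∞) (_ : AEMeasurable f circleMeasure) (_ : ρ.toFun f ≤ 1),
    ∫⁻ t, f t * g t ∂circleMeasure

/-- A weight: a measurable function `w : 𝕋 → [0,∞]` with `0 < w < ∞` almost everywhere. -/
structure CircleWeight where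
  /-- the underlying function -/
  toFun : UCircle → ℝ≥0∞
  measurable : Measurable toFun
  pos : ∀ᵐ t ∂circleMeasure, 0 < toFun t
  lt_top : ∀ᵐ t ∂circleMeasure, toFun t < ∞

/-- The weight that is identically `1`. -/
instance : One CircleWeight where
  one :=
    { toFun := fun _ => 1
      measurable := measurable_const
      pos := Eventually.of_forall fun _ => one_pos
      lt_top := Eventually.of_forall fun _ => ENNReal.one_lt_top }

/-- `ρ(|f| w)`, the norm of `f` in `X(w)` as an element of `[0,∞]`; here `X` is the Banach function
space given by `ρ`. -/
noncomputable def weightedENorm (ρ : BanachFunctionNorm) (w : CircleWeight)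
    (f : UCircle →ₘ[circleMeasure] ℂ) : ℝ≥0∞ :=
  ρ.toFun (fun t => ‖f t‖ₑ * w.toFun t)

section aux

variable (ρ : BanachFunctionNorm) (w : CircleWeight)

theorem aemeasurable_enorm_mul_weight (f : UCircle →ₘ[circleMeasure] ℂ) :
    AEMeasurable (fun t => ‖f t‖ₑ * w.toFun t) circleMeasure :=
  f.aestronglyMeasurable.enorm.mul w.measurable.aemeasurable

theorem weightedENorm_eq_zero {f : UCircle →ₘ[circleMeasure] ℂ} :
    weightedENorm ρ w f = 0 ↔ f = 0 := by
  rw [weightedENorm, ρ.eq_zero_iff _ (aemeasurable_enorm_mul_weight w f)]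
  constructor
  · intro h
    apply AEEqFun.ext
    filter_upwards [h, w.pos, AEEqFun.coeFn_zero (μ := circleMeasure) (β := ℂ)] with t ht hw h0
    rw [h0]
    simpa [hw.ne'] using ht
  · rintro rfl
    filter_upwards [AEEqFun.coeFn_zero (μ := circleMeasure) (β := ℂ)] with t h0
    simp [h0]

theorem weightedENorm_add_le (f g : UCircle →ₘ[circleMeasure] ℂ) :
    weightedENorm ρ w (f + g) ≤ weightedENorm ρ w f + weightedENorm ρ w g := by
  refine (ρ.mono _ _ ((aemeasurable_enorm_mul_weight w f).add
    (aemeasurable_enorm_mul_weight w g)) (aemeasurable_enorm_mul_weight w (f + g)) ?_).trans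
    (ρ.add_le _ _ (aemeasurable_enorm_mul_weight w f) (aemeasurable_enorm_mul_weight w g))
  filter_upwards [AEEqFun.coeFn_add f g] with t ht
  simp only [ht, Pi.add_apply, ← add_mul]
  gcongr
  exact enorm_add_le _ _

theorem weightedENorm_smul (c : ℂ) (f : UCircle →ₘ[circleMeasure] ℂ) :
    weightedENorm ρ w (c • f) = ‖c‖ₑ * weightedENorm ρ w f := by
  have key : (fun t => ‖(c • f) t‖ₑ * w.toFun t) =ᵐ[circleMeasure]
      fun t => (‖c‖₊ : ℝ≥0∞) * (‖f t‖ₑ * w.toFun t) := by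
    filter_upwards [AEEqFun.coeFn_smul c f] with t ht
    rw [ht, Pi.smul_apply, smul_eq_mul, enorm_mul, mul_assoc, enorm_eq_nnnorm]
  have h1 := aemeasurable_enorm_mul_weight w (c • f)
  have h2 := (aemeasurable_enorm_mul_weight w f).const_mul (‖c‖₊ : ℝ≥0∞)
  have := le_antisymm (ρ.mono _ _ h2 h1 key.le) (ρ.mono _ _ h1 h2 key.symm.le)
  rw [weightedENorm, this, ρ.smul _ _ (aemeasurable_enorm_mul_weight w f)]
  rfl

end aux

/-- The weighted space `X(w) = {f : f w ∈ X}`, functions being identified when equal a.e.; the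
space `X` itself is `X(1)`. -/
noncomputable def weightedSpace (ρ : BanachFunctionNorm) (w : CircleWeight) :
    Submodule ℂ (UCircle →ₘ[circleMeasure] ℂ) where
  carrier := {f | weightedENorm ρ w f < ∞}
  zero_mem' := by
    simp [(weightedENorm_eq_zero ρ w).2 rfl]
  add_mem' {f g} hf hg :=
    (weightedENorm_add_le ρ w f g).trans_lt (ENNReal.add_lt_top.2 ⟨hf, hg⟩)
  smul_mem' c f hf := by
    change weightedENorm ρ w (c • f) < ∞
    rw [weightedENorm_smul]
    exact ENNReal.mul_lt_top enorm_lt_top hf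

/-- The functions in `X(w)` with vanishing Fourier coefficients of negative index. Fourier
coefficients are those of functions in `L¹`; the integrability demanded here is automatic as soon
as `1/w ∈ X'`. -/
noncomputable def hardySubmodule (ρ : BanachFunctionNorm) (w : CircleWeight) :
    Submodule ℂ (UCircle →ₘ[circleMeasure] ℂ) where
  carrier := {f | f ∈ weightedSpace ρ w ∧ Integrable f circleMeasure ∧
    ∀ n : ℤ, n < 0 → fourierCoeff f n = 0}
  zero_mem' := by
    refine ⟨zero_mem _, (integrable_zero _ _ _).congr AEEqFun.coeFn_zero.symm, fun n _ => ?_⟩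
    rw [fourierCoeff_congr_ae (AEEqFun.coeFn_zero (μ := circleMeasure) (β := ℂ))]
    simp [fourierCoeff]
  add_mem' := by
    rintro f g ⟨hf, hfi, hf0⟩ ⟨hg, hgi, hg0⟩
    refine ⟨add_mem hf hg, (hfi.add hgi).congr (AEEqFun.coeFn_add f g).symm, fun n hn => ?_⟩
    rw [fourierCoeff_congr_ae (AEEqFun.coeFn_add f g), fourierCoeff.add hfi hgi, Pi.add_apply,
      hf0 n hn, hg0 n hn, add_zero]
  smul_mem' := by
    rintro c f ⟨hf, hfi, hf0⟩
    refine ⟨Submodule.smul_mem _ c hf, (hfi.smul c).congr (AEEqFun.coeFn_smul c f).symm,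
      fun n hn => ?_⟩
    rw [fourierCoeff_congr_ae (AEEqFun.coeFn_smul c f)]
    have := fourierCoeff.const_smul f c n
    rw [hf0 n hn, smul_zero] at this
    exact this

/-- The abstract Hardy space `H[X(w)]`; the space `H[X]` is `H[X(1)]`. -/
def HardySpace (ρ : BanachFunctionNorm) (w : CircleWeight) : Type := hardySubmodule ρ w

namespace HardySpace

variable {ρ : BanachFunctionNorm} {w : CircleWeight}

noncomputable instance : AddCommGroup (HardySpace ρ w) :=
  inferInstanceAs (AddCommGroup (hardySubmodule ρ w))

noncomputable instance : Module ℂ (HardySpace ρ w) :=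
  inferInstanceAs (Module ℂ (hardySubmodule ρ w))

/-- The class (modulo equality a.e.) underlying an element of `H[X(w)]`. -/
def toAEEqFun (f : HardySpace ρ w) : UCircle →ₘ[circleMeasure] ℂ :=
  Subtype.val (p := fun g => g ∈ hardySubmodule ρ w) f

/-- The norm `‖f‖ = ρ(|f| w)` of `X(w)`, on `H[X(w)]`. -/
noncomputable instance : Norm (HardySpace ρ w) where
  norm f := (weightedENorm ρ w f.toAEEqFun).toReal

theorem norm_def (f : HardySpace ρ w) : ‖f‖ = (weightedENorm ρ w f.toAEEqFun).toReal := rfl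

theorem weightedENorm_ne_top (f : HardySpace ρ w) : weightedENorm ρ w f.toAEEqFun ≠ ∞ :=
  ne_of_lt (Subtype.property (p := fun g => g ∈ hardySubmodule ρ w) f).1

theorem normCore : NormedSpace.Core ℂ (HardySpace ρ w) where
  norm_nonneg _ := ENNReal.toReal_nonneg
  norm_smul c f := by
    have h : (c • f).toAEEqFun = c • f.toAEEqFun := rfl
    rw [norm_def, norm_def, h, weightedENorm_smul, ENNReal.toReal_mul, toReal_enorm]
  norm_triangle f g := by
    have h : (f + g).toAEEqFun = f.toAEEqFun + g.toAEEqFun := rfl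
    rw [norm_def, norm_def, norm_def, h, ← ENNReal.toReal_add f.weightedENorm_ne_top
      g.weightedENorm_ne_top]
    exact ENNReal.toReal_mono
      (ENNReal.add_ne_top.2 ⟨f.weightedENorm_ne_top, g.weightedENorm_ne_top⟩)
      (weightedENorm_add_le ρ w _ _)
  norm_eq_zero_iff f := by
    rw [norm_def, ENNReal.toReal_eq_zero_iff, or_iff_left f.weightedENorm_ne_top,
      weightedENorm_eq_zero]
    exact ⟨fun h => Subtype.ext h, fun h => by rw [h]; rfl⟩

noncomputable instance : NormedAddCommGroup (HardySpace ρ w) := NormedAddCommGroup.ofCore normCore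

noncomputable instance : NormedSpace ℂ (HardySpace ρ w) := NormedSpace.ofCore normCore

end HardySpace

/-- The space `H^∞`: essentially bounded functions with vanishing Fourier coefficients of negative
index. -/
def MemHInfty (h : UCircle → ℂ) : Prop :=
  MemLp h ∞ circleMeasure ∧ ∀ n : ℤ, n < 0 → fourierCoeff h n = 0

/-- `(1/(πi)) ∫_{|τ - t| > ε} f(τ) / (τ - t) dτ`, the truncated Cauchy singular integral. The line
element is `dτ = i τ dθ = 2πi τ dm(τ)`. -/
noncomputable def truncatedCauchy (f : UCircle → ℂ) (t : UCircle) (ε : ℝ) : ℂ :=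
  1 / (Real.pi * Complex.I) *
    ∫ s in {s : UCircle | ε < ‖circlePt s - circlePt t‖},
      f s / (circlePt s - circlePt t) * (2 * Real.pi * Complex.I * circlePt s) ∂circleMeasure

/-- The Cauchy singular integral `(S f)(t)` exists as a principal value and equals `z`. -/
def HasCauchySingularIntegral (f : UCircle → ℂ) (t : UCircle) (z : ℂ) : Prop :=
  Tendsto (truncatedCauchy f t) (𝓝[>] 0) (𝓝 z)

/-- `g = P f` for the Riesz projection `P = (I + S)/2`, defined for `f ∈ L¹`: at almost every point
`t` the principal value `(S f)(t)` exists and `g(t) = (f(t) + (S f)(t))/2`. -/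
def IsRieszProjection (f g : UCircle → ℂ) : Prop :=
  Integrable f circleMeasure ∧
    ∀ᵐ t ∂circleMeasure, ∃ z : ℂ, HasCauchySingularIntegral f t z ∧ g t = (f t + z) / 2

/-- `A` is the Toeplitz operator `T(a) : f ↦ P(a f)`, as a bounded operator on `H[X(w)]`. -/
def IsToeplitz {ρ : BanachFunctionNorm} {w : CircleWeight} (a : UCircle → ℂ)
    (A : HardySpace ρ w →L[ℂ] HardySpace ρ w) : Prop :=
  ∀ f : HardySpace ρ w, IsRieszProjection (fun t => a t * f.toAEEqFun t) (A f).toAEEqFun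

/-- The essential norm `inf {‖A - K‖ : K compact}`. -/
noncomputable def essentialNorm {E : Type*} [NormedAddCommGroup E] [NormedSpace ℂ E]
    (A : E →L[ℂ] E) : ℝ :=
  sInf {r : ℝ | ∃ K : E →L[ℂ] E, IsCompactOperator K ∧ r = ‖A - K‖}

/-! For `g` in `H¹` the projection `P` acts on `e₋ₙ g` by discarding the `n` terms of negative
frequency, so `T(e₋ₙ h) f = e₋ₙ (h f - ∑_{k<n} (h f)^(k) eₖ)`. This explicit formula makes the
operator bounded without any boundedness of `P`: the coefficients are controlled by the `L¹` norm,
hence by the norm of `X(w)` because `1/w ∈ X'`, and the polynomials removed lie in `X(w)` because `w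
∈ X`.

Since `w` and `1/w` are integrable, there is an outer function `W` with `|W| = w`, and `f ↦ W f` is
an isometric isomorphism from `H[X(w)]` onto `H[X]` (`IsOuter.isometryEquiv`). Where the first `n`
coefficients of both `h f` and `h W f` vanish, both Toeplitz operators are plain multiplication by
`e₋ₙ h`, which commutes with `W`. So transporting one operator by `W` changes the other only by an
operator that vanishes on a subspace of finite codimension. That difference is compact
(`isCompactOperator_isometryConj_sub`), and the essential norm does not see it.

Two analytic facts carry this. One is the existence of `W` (`exists_isOuter`), obtained on the
boundary alone: exponentials of analytic polynomials are outer, and an `L²` identity for their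
quotients yields a.e. convergent subsequences. It also gives `H^∞ · H¹ ⊆ H¹`
(`MemHInfty.isHOne_mul`). The other is that the principal value `S` is the identity on `H¹`
(`IsHOne.ae_hasCauchySingularIntegral`) and minus the identity on negative frequencies. It is proved
at Lebesgue points by comparing the truncated kernel with a Cauchy kernel whose pole lies outside
the disc. -/

/-! ### Fourier coefficients and the class `H¹` -/

theorem fourier_eq_circlePt_zpow (n : ℤ) (t : UCircle) : fourier n t = circlePt t ^ n := by
  rw [fourier_apply, AddCircle.toCircle_zsmul, circlePt, Circle.coe_zpow]

theorem norm_circlePt (t : UCircle) : ‖circlePt t‖ = 1 := Circle.norm_coe _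

theorem circlePt_ne_zero (t : UCircle) : circlePt t ≠ 0 := Circle.coe_ne_zero _

theorem continuous_circlePt : Continuous circlePt :=
  continuous_subtype_val.comp AddCircle.continuous_toCircle

theorem norm_fourier_apply (n : ℤ) (t : UCircle) : ‖fourier n t‖ = 1 := by
  rw [fourier_apply, Circle.norm_coe]

theorem aestronglyMeasurable_fourier (n : ℤ) :
    AEStronglyMeasurable (fun t : UCircle => fourier n t) circleMeasure :=
  (map_continuous (fourier n)).aestronglyMeasurable

theorem fourierCoeff_zero_eq_integral (f : UCircle → ℂ) :
    fourierCoeff f 0 = ∫ t, f t ∂circleMeasure := by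
  simp [fourierCoeff]

theorem fourierCoeff_mul_fourier (f : UCircle → ℂ) (k n : ℤ) :
    fourierCoeff (fun t => f t * fourier k t) n = fourierCoeff f (n - k) := by
  simp only [fourierCoeff, smul_eq_mul]
  congr 1 with t
  rw [show -(n - k) = -n + k by ring, fourier_add]
  ring

theorem MeasureTheory.Integrable.mul_fourier {f : UCircle → ℂ} (hf : Integrable f circleMeasure)
    (k : ℤ) : Integrable (fun t => f t * fourier k t) circleMeasure := by
  simpa only [smul_eq_mul, mul_comm] using hf.fourier_smul k

theorem fourierCoeff_add_apply {f g : UCircle → ℂ} (hf : Integrable f circleMeasure)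
    (hg : Integrable g circleMeasure) (n : ℤ) :
    fourierCoeff (fun t => f t + g t) n = fourierCoeff f n + fourierCoeff g n :=
  congr_fun (fourierCoeff.add hf hg) n

theorem fourierCoeff_sub_apply {f g : UCircle → ℂ} (hf : Integrable f circleMeasure)
    (hg : Integrable g circleMeasure) (n : ℤ) :
    fourierCoeff (fun t => f t - g t) n = fourierCoeff f n - fourierCoeff g n := by
  have := fourierCoeff_add_apply hf (hg.const_mul (-1)) n
  rw [fourierCoeff.const_mul] at this
  simpa [sub_eq_add_neg] using this

theorem fourierCoeff_sum_apply {ι : Type*} (s : Finset ι) (f : ι → UCircle → ℂ)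
    (hf : ∀ i ∈ s, Integrable (f i) circleMeasure) (n : ℤ) :
    fourierCoeff (fun t => ∑ i ∈ s, f i t) n = ∑ i ∈ s, fourierCoeff (f i) n := by
  have h := congr_fun (fourierCoeff.sum s f hf) n
  rw [Finset.sum_apply] at h
  rw [← h]
  congr 1
  ext t
  simp

theorem fourierCoeff_fourier_apply (k n : ℤ) :
    fourierCoeff (fun t : UCircle => fourier k t) n = if n = k then 1 else 0 := by
  have := congr_fun (fourierCoeff_fourier (T := 2 * Real.pi) k) n
  rw [this, Pi.single_apply]

theorem fourierCoeff_const (c : ℂ) (n : ℤ) :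
    fourierCoeff (fun _ : UCircle => c) n = if n = 0 then c else 0 := by
  have h := fourierCoeff.const_mul (fun t : UCircle => fourier 0 t) c n
  rw [fourierCoeff_fourier_apply] at h
  simpa using h

/-- Membership in the Hardy space `H¹`. -/
def IsHOne (f : UCircle → ℂ) : Prop :=
  Integrable f circleMeasure ∧ ∀ n : ℤ, n < 0 → fourierCoeff f n = 0

namespace IsHOne

variable {f g : UCircle → ℂ}

theorem congr_ae (hf : IsHOne f) (h : f =ᵐ[circleMeasure] g) : IsHOne g :=
  ⟨hf.1.congr h, fun n hn => by rw [← fourierCoeff_congr_ae h, hf.2 n hn]⟩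

theorem add (hf : IsHOne f) (hg : IsHOne g) : IsHOne (fun t => f t + g t) :=
  ⟨hf.1.add hg.1, fun n hn => by
    rw [fourierCoeff_add_apply hf.1 hg.1, hf.2 n hn, hg.2 n hn, add_zero]⟩

theorem sub (hf : IsHOne f) (hg : IsHOne g) : IsHOne (fun t => f t - g t) :=
  ⟨hf.1.sub hg.1, fun n hn => by
    rw [fourierCoeff_sub_apply hf.1 hg.1, hf.2 n hn, hg.2 n hn, sub_zero]⟩

theorem const_mul (hf : IsHOne f) (c : ℂ) : IsHOne (fun t => c * f t) :=
  ⟨hf.1.const_mul c, fun n hn => by rw [fourierCoeff.const_mul, hf.2 n hn, mul_zero]⟩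

theorem mul_fourier (hf : IsHOne f) {k : ℤ} (hk : 0 ≤ k) : IsHOne (fun t => f t * fourier k t) :=
  ⟨hf.1.mul_fourier k, fun n hn => by rw [fourierCoeff_mul_fourier, hf.2 _ (by omega)]⟩

theorem const (c : ℂ) : IsHOne (fun _ => c) :=
  ⟨integrable_const c, fun n hn => by rw [fourierCoeff_const, if_neg hn.ne]⟩

end IsHOne

theorem tendsto_fourierCoeff_of_dominated {F : ℕ → UCircle → ℂ} {G : UCircle → ℂ}
    {b : UCircle → ℝ} (hF : ∀ j, AEStronglyMeasurable (F j) circleMeasure)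
    (hb : Integrable b circleMeasure) (hFb : ∀ j, ∀ᵐ t ∂circleMeasure, ‖F j t‖ ≤ b t)
    (hlim : ∀ᵐ t ∂circleMeasure, Tendsto (fun j => F j t) atTop (𝓝 (G t))) (n : ℤ) :
    Tendsto (fun j => fourierCoeff (F j) n) atTop (𝓝 (fourierCoeff G n)) := by
  refine tendsto_integral_of_dominated_convergence b
    (fun j => (aestronglyMeasurable_fourier _).smul (hF j)) hb (fun j => ?_) ?_
  · filter_upwards [hFb j] with t ht
    rwa [norm_smul, norm_fourier_apply, one_mul]
  · filter_upwards [hlim] with t ht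
    exact ht.const_smul _

theorem integrable_of_dominated_limit {F : ℕ → UCircle → ℂ} {G : UCircle → ℂ}
    {b : UCircle → ℝ} (hF : ∀ j, AEStronglyMeasurable (F j) circleMeasure)
    (hb : Integrable b circleMeasure) (hFb : ∀ j, ∀ᵐ t ∂circleMeasure, ‖F j t‖ ≤ b t)
    (hlim : ∀ᵐ t ∂circleMeasure, Tendsto (fun j => F j t) atTop (𝓝 (G t))) :
    Integrable G circleMeasure := by
  refine hb.mono' (aestronglyMeasurable_of_tendsto_ae atTop hF hlim) ?_
  filter_upwards [hlim, ae_all_iff.2 hFb] with t ht htb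
  exact le_of_tendsto ht.norm (Eventually.of_forall htb)

theorem IsHOne.of_dominated_limit {F : ℕ → UCircle → ℂ} {G : UCircle → ℂ}
    {b : UCircle → ℝ} (hF : ∀ j, IsHOne (F j))
    (hb : Integrable b circleMeasure) (hFb : ∀ j, ∀ᵐ t ∂circleMeasure, ‖F j t‖ ≤ b t)
    (hlim : ∀ᵐ t ∂circleMeasure, Tendsto (fun j => F j t) atTop (𝓝 (G t))) : IsHOne G := by
  refine ⟨integrable_of_dominated_limit (fun j => (hF j).1.1) hb hFb hlim, fun n hn => ?_⟩
  have := tendsto_fourierCoeff_of_dominated (fun j => (hF j).1.1) hb hFb hlim n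
  simp only [(hF _).2 n hn] at this
  exact tendsto_nhds_unique this tendsto_const_nhds

/-! ### Bounded multipliers of `H¹`, with the mean value as evaluation at the origin -/

/-- `V` is bounded, multiplication by `V` preserves `H¹`, and it multiplies mean values by `c`. -/
structure IsMultiplier (V : UCircle → ℂ) (c : ℂ) : Prop where
  aestronglyMeasurable : AEStronglyMeasurable V circleMeasure
  bounded : ∃ C : ℝ, ∀ᵐ t ∂circleMeasure, ‖V t‖ ≤ C
  isHOne_mul : ∀ f, IsHOne f → IsHOne (fun t => f t * V t)
  integral_mul : ∀ f, IsHOne f →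
    ∫ t, f t * V t ∂circleMeasure = c * ∫ t, f t ∂circleMeasure

namespace IsMultiplier

variable {U V : UCircle → ℂ} {c d : ℂ}

theorem const (c : ℂ) : IsMultiplier (fun _ => c) c where
  aestronglyMeasurable := aestronglyMeasurable_const
  bounded := ⟨‖c‖, Eventually.of_forall fun _ => le_rfl⟩
  isHOne_mul f hf := by simpa only [mul_comm] using hf.const_mul c
  integral_mul f hf := by rw [integral_mul_const, mul_comm]

theorem fourier_of_pos {k : ℤ} (hk : 0 < k) : IsMultiplier (fun t => fourier k t) 0 where
  aestronglyMeasurable := aestronglyMeasurable_fourier k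
  bounded := ⟨1, Eventually.of_forall fun t => (norm_fourier_apply k t).le⟩
  isHOne_mul f hf := hf.mul_fourier hk.le
  integral_mul f hf := by
    rw [← fourierCoeff_zero_eq_integral, fourierCoeff_mul_fourier, hf.2 _ (by omega), zero_mul]

theorem add (hU : IsMultiplier U c) (hV : IsMultiplier V d) :
    IsMultiplier (fun t => U t + V t) (c + d) where
  aestronglyMeasurable := hU.1.add hV.1
  bounded := by
    obtain ⟨C, hC⟩ := hU.bounded
    obtain ⟨D, hD⟩ := hV.bounded
    refine ⟨C + D, ?_⟩
    filter_upwards [hC, hD] with t h1 h2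
    exact (norm_add_le _ _).trans (add_le_add h1 h2)
  isHOne_mul f hf := by
    simpa only [mul_add] using (hU.isHOne_mul f hf).add (hV.isHOne_mul f hf)
  integral_mul f hf := by
    simp only [mul_add]
    rw [integral_add (hU.isHOne_mul f hf).1 (hV.isHOne_mul f hf).1, hU.integral_mul f hf,
      hV.integral_mul f hf, add_mul]

theorem mul (hU : IsMultiplier U c) (hV : IsMultiplier V d) :
    IsMultiplier (fun t => U t * V t) (c * d) where
  aestronglyMeasurable := hU.1.mul hV.1
  bounded := by
    obtain ⟨C, hC⟩ := hU.bounded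
    obtain ⟨D, hD⟩ := hV.bounded
    refine ⟨C * D, ?_⟩
    filter_upwards [hC, hD] with t h1 h2
    rw [norm_mul]
    exact mul_le_mul h1 h2 (norm_nonneg _) ((norm_nonneg _).trans h1)
  isHOne_mul f hf := by
    simpa only [mul_assoc] using hV.isHOne_mul _ (hU.isHOne_mul f hf)
  integral_mul f hf := by
    have := hV.integral_mul _ (hU.isHOne_mul f hf)
    simp only [mul_assoc] at this
    rw [this, hU.integral_mul f hf]
    ring

theorem const_mul (hU : IsMultiplier U c) (a : ℂ) : IsMultiplier (fun t => a * U t) (a * c) :=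
  (const a).mul hU

theorem pow (hU : IsMultiplier U c) (k : ℕ) : IsMultiplier (fun t => U t ^ k) (c ^ k) := by
  induction k with
  | zero => simpa using const 1
  | succ k ih => simpa only [pow_succ] using ih.mul hU

theorem sum {ι : Type*} (s : Finset ι) {U : ι → UCircle → ℂ} {c : ι → ℂ}
    (h : ∀ i ∈ s, IsMultiplier (U i) (c i)) :
    IsMultiplier (fun t => ∑ i ∈ s, U i t) (∑ i ∈ s, c i) := by
  classical
  induction s using Finset.induction_on with
  | empty => simpa using const 0
  | insert a s ha ih =>
    simp only [Finset.sum_insert ha]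
    exact (h a (Finset.mem_insert_self _ _)).add
      (ih fun i hi => h i (Finset.mem_insert_of_mem hi))

/-- The uniform bound `C` gives `f * V j` the integrable majorant `‖f‖ * C`, so coefficients and
means pass to the limit. This is the only limit process used to build bounded multipliers. -/
theorem of_tendsto {V : ℕ → UCircle → ℂ} {c : ℕ → ℂ} {U : UCircle → ℂ} {d : ℂ} {C : ℝ}
    (hV : ∀ j, IsMultiplier (V j) (c j)) (hC : ∀ j, ∀ᵐ t ∂circleMeasure, ‖V j t‖ ≤ C)
    (hlim : ∀ᵐ t ∂circleMeasure, Tendsto (fun j => V j t) atTop (𝓝 (U t)))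
    (hc : Tendsto c atTop (𝓝 d)) : IsMultiplier U d := by
  have key : ∀ f, IsHOne f → (∀ j, ∀ᵐ t ∂circleMeasure, ‖f t * V j t‖ ≤ ‖f t‖ * C) ∧
      ∀ᵐ t ∂circleMeasure, Tendsto (fun j => f t * V j t) atTop (𝓝 (f t * U t)) := by
    refine fun f hf => ⟨fun j => ?_, ?_⟩
    · filter_upwards [hC j] with t ht
      rw [norm_mul]
      gcongr
    · filter_upwards [hlim] with t ht
      exact ht.const_mul _
  refine ⟨aestronglyMeasurable_of_tendsto_ae atTop (fun j => (hV j).1) hlim, ⟨C, ?_⟩,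
    fun f hf => ?_, fun f hf => ?_⟩
  · filter_upwards [hlim, ae_all_iff.2 hC] with t ht htb
    exact le_of_tendsto ht.norm (Eventually.of_forall htb)
  · exact .of_dominated_limit (fun j => (hV j).isHOne_mul f hf) (hf.1.norm.mul_const C)
      (key f hf).1 (key f hf).2
  · have h1 := tendsto_integral_of_dominated_convergence _
      (fun j => ((hV j).isHOne_mul f hf).1.1) (hf.1.norm.mul_const C) (key f hf).1 (key f hf).2
    simp only [(hV _).integral_mul f hf] at h1
    exact tendsto_nhds_unique h1 (hc.mul_const _)

/-- The partial sums of the exponential series are polynomials in `U`, hence multipliers, and are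
uniformly bounded by `exp C`. -/
theorem cexp (hU : IsMultiplier U c) :
    IsMultiplier (fun t => Complex.exp (U t)) (Complex.exp c) := by
  obtain ⟨C, hC⟩ := hU.bounded
  have hexp : ∀ z : ℂ, Tendsto (fun n => ∑ k ∈ Finset.range n, ((k.factorial : ℂ)⁻¹ * z ^ k)) atTop
      (𝓝 (Complex.exp z)) := by
    intro z
    have := (NormedSpace.expSeries_div_hasSum_exp z).tendsto_sum_nat
    rw [← Complex.exp_eq_exp_ℂ] at this
    simpa only [div_eq_inv_mul] using this
  refine of_tendsto (C := Real.exp C)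
    (fun n => sum (Finset.range n) fun k _ => (hU.pow k).const_mul ((k.factorial : ℂ)⁻¹))
    (fun n => ?_) (Eventually.of_forall fun t => hexp (U t)) (hexp c)
  filter_upwards [hC] with t ht
  refine (norm_sum_le _ _).trans ?_
  calc ∑ k ∈ Finset.range n, ‖(k.factorial : ℂ)⁻¹ * U t ^ k‖
      = ∑ k ∈ Finset.range n, ‖U t‖ ^ k / k.factorial := by
        refine Finset.sum_congr rfl fun k _ => ?_
        rw [norm_mul, norm_pow, norm_inv, div_eq_inv_mul]
        simp
    _ ≤ Real.exp ‖U t‖ := Real.sum_le_exp_of_nonneg (norm_nonneg _) n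
    _ ≤ Real.exp C := Real.exp_le_exp.2 ht

end IsMultiplier

/-! ### Bounded outer functions: almost everywhere convergence from convergence of moduli -/

/-- `V` is a bounded outer function with `|V| = exp u`, normalised to be positive at the origin. -/
structure IsBoundedOuter (u : UCircle → ℝ) (V : UCircle → ℂ) : Prop where
  aestronglyMeasurable : AEStronglyMeasurable u circleMeasure
  bounded : ∃ C : ℝ, ∀ᵐ t ∂circleMeasure, |u t| ≤ C
  norm_eq : ∀ᵐ t ∂circleMeasure, ‖V t‖ = Real.exp (u t)
  isMultiplier : IsMultiplier V (Real.exp (∫ t, u t ∂circleMeasure) : ℝ)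
  isMultiplier_inv :
    IsMultiplier (fun t => (V t)⁻¹) (Real.exp (-∫ t, u t ∂circleMeasure) : ℝ)

namespace IsBoundedOuter

variable {u v : UCircle → ℝ} {U V : UCircle → ℂ}

theorem integrable (hU : IsBoundedOuter u U) : Integrable u circleMeasure := by
  obtain ⟨C, hC⟩ := hU.bounded
  exact (integrable_const C).mono' hU.1 hC

/-- Expand `|q - 1|² = |q|² + 1 - 2 Re q` with `q = U / V`. Here `|q|` is known pointwise, and the
mean of `q` is its value at the origin, which is known because both factors are multipliers. Hence
the `L²` distance of `q` from `1` depends on the moduli only, and no conjugate function has to be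
estimated. -/
theorem integral_norm_div_sub_one_sq (hU : IsBoundedOuter u U) (hV : IsBoundedOuter v V) :
    ∫ t, ‖U t * (V t)⁻¹ - 1‖ ^ 2 ∂circleMeasure =
      ∫ t, Real.exp (2 * (u t - v t)) ∂circleMeasure + 1
        - 2 * Real.exp (∫ t, (u t - v t) ∂circleMeasure) := by
  have hM := hU.isMultiplier.mul hV.isMultiplier_inv
  have hint : Integrable (fun t => U t * (V t)⁻¹) circleMeasure := by
    simpa using (hM.isHOne_mul _ (.const 1)).1
  have hval : ∫ t, U t * (V t)⁻¹ ∂circleMeasure =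
      (Real.exp (∫ t, (u t - v t) ∂circleMeasure) : ℝ) := by
    have := hM.integral_mul _ (.const 1)
    simp only [one_mul, integral_const, probReal_univ, one_smul, mul_one] at this
    rw [this, integral_sub hU.integrable hV.integrable, sub_eq_add_neg, Real.exp_add]
    push_cast
    rfl
  have hexp : Integrable (fun t => Real.exp (2 * (u t - v t))) circleMeasure := by
    obtain ⟨C, hC⟩ := hU.bounded
    obtain ⟨D, hD⟩ := hV.bounded
    refine (integrable_const (Real.exp (2 * (C + D)))).mono'
      (Real.continuous_exp.comp_aestronglyMeasurable ((hU.1.sub hV.1).const_mul 2)) ?_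
    filter_upwards [hC, hD] with t h1 h2
    rw [Real.norm_of_nonneg (Real.exp_pos _).le, Real.exp_le_exp]
    linarith [le_abs_self (u t), neg_abs_le (v t)]
  have hpt : ∀ᵐ t ∂circleMeasure, ‖U t * (V t)⁻¹ - 1‖ ^ 2 =
      Real.exp (2 * (u t - v t)) + 1 - 2 * (U t * (V t)⁻¹).re := by
    filter_upwards [hU.norm_eq, hV.norm_eq] with t h1 h2
    have h3 : Real.exp (2 * (u t - v t)) = ‖U t * (V t)⁻¹‖ ^ 2 := by
      rw [norm_mul, norm_inv, h1, h2, ← Real.exp_neg, ← Real.exp_add, ← Real.exp_nat_mul]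
      congr 1
    rw [h3, Complex.sq_norm, Complex.sq_norm, Complex.normSq_sub]
    simp
  have hre : ∫ t, (U t * (V t)⁻¹).re ∂circleMeasure =
      Real.exp (∫ t, (u t - v t) ∂circleMeasure) := by
    have := integral_re hint
    rw [hval] at this
    exact this.trans (Complex.ofReal_re _)
  have hre_int : Integrable (fun t => 2 * (U t * (V t)⁻¹).re) circleMeasure :=
    hint.re.const_mul 2
  have hexp_int : Integrable (fun t => Real.exp (2 * (u t - v t)) + 1) circleMeasure :=
    hexp.add (integrable_const _)
  rw [integral_congr_ae hpt, integral_sub hexp_int hre_int,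
    integral_add hexp (integrable_const _), integral_const_mul, hre]
  simp

end IsBoundedOuter

/-- The series `∑ 2^k ‖x k‖²` has finite integral, so it converges a.e., and `2 ‖x k‖ ≤ 2^k ‖x k‖² +
2^(-k)`. -/
theorem ae_summable_norm_of_integral_sq_le {x : ℕ → UCircle → ℂ}
    (hi : ∀ k, Integrable (fun t => ‖x k t‖ ^ 2) circleMeasure)
    (hle : ∀ k, ∫ t, ‖x k t‖ ^ 2 ∂circleMeasure ≤ (1 / 4 : ℝ) ^ k) :
    ∀ᵐ t ∂circleMeasure, Summable fun k => ‖x k t‖ := by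
  have hsum : ∑' k, ∫⁻ t, ENNReal.ofReal (2 ^ k * ‖x k t‖ ^ 2) ∂circleMeasure ≠ ∞ := by
    refine ne_top_of_le_ne_top (b := ∑' k : ℕ, ENNReal.ofReal ((1 / 2 : ℝ) ^ k)) ?_ ?_
    · rw [← ENNReal.ofReal_tsum_of_nonneg (fun k => by positivity)
        (summable_geometric_of_lt_one (by norm_num) (by norm_num))]
      exact ENNReal.ofReal_ne_top
    · refine ENNReal.tsum_le_tsum fun k => ?_
      rw [← ofReal_integral_eq_lintegral_ofReal ((hi k).const_mul _)
        (Eventually.of_forall fun t => by positivity), integral_const_mul]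
      refine ENNReal.ofReal_le_ofReal ?_
      calc (2 : ℝ) ^ k * ∫ t, ‖x k t‖ ^ 2 ∂circleMeasure ≤ 2 ^ k * (1 / 4) ^ k := by
            gcongr; exact hle k
        _ = (1 / 2) ^ k := by rw [← mul_pow]; norm_num
  have hmeas : ∀ k, AEMeasurable (fun t => ENNReal.ofReal (2 ^ k * ‖x k t‖ ^ 2)) circleMeasure :=
    fun k => ((hi k).1.aemeasurable.const_mul _).ennreal_ofReal
  rw [← lintegral_tsum hmeas] at hsum
  filter_upwards [ae_lt_top' (AEMeasurable.tsum hmeas) hsum] with t ht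
  have h1 : Summable fun k => (2 : ℝ) ^ k * ‖x k t‖ ^ 2 := by
    have := ENNReal.summable_toReal ht.ne
    simpa only [ENNReal.toReal_ofReal (show (0:ℝ) ≤ 2 ^ _ * ‖x _ t‖ ^ 2 by positivity)] using this
  have h2 : Summable fun k : ℕ => (1 / 2 : ℝ) ^ k :=
    summable_geometric_of_lt_one (by norm_num) (by norm_num)
  refine .of_nonneg_of_le (fun k => norm_nonneg _) (fun k => ?_) (h1.add h2)
  have h3 : (2 : ℝ) ^ k * (1 / 2) ^ k = 1 := by rw [← mul_pow]; norm_num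
  have h4 : (0 : ℝ) < 2 ^ k := by positivity
  have h5 : (0 : ℝ) < (1 / 2) ^ k := by positivity
  nlinarith [sq_nonneg (2 ^ k * ‖x k t‖ - 1), norm_nonneg (x k t),
    mul_nonneg h5.le (sq_nonneg (2 ^ k * ‖x k t‖ - 1)),
    show (1 / 2 : ℝ) ^ k * (2 ^ k * ‖x k t‖ - 1) ^ 2 =
      2 ^ k * ‖x k t‖ ^ 2 - 2 * ‖x k t‖ + (1 / 2) ^ k by
        linear_combination (2 ^ k * ‖x k t‖ ^ 2 - 2 * ‖x k t‖) * h3]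

/-- Dominated convergence sends the first integral to `1` and the second to `0`, and `1 + 1 - 2 =
0`. The pairs are restricted to `p.2 ≤ p.1` because the exponential majorant is assumed only in that
order. -/
theorem tendsto_integral_exp_sub {u : ℕ → UCircle → ℝ} {u₀ : UCircle → ℝ} {b b' : UCircle → ℝ}
    (hu : ∀ j, AEStronglyMeasurable (u j) circleMeasure)
    (hlim : ∀ᵐ t ∂circleMeasure, Tendsto (fun j => u j t) atTop (𝓝 (u₀ t)))
    (hb : Integrable b circleMeasure) (hb' : Integrable b' circleMeasure)
    (hub : ∀ i j, j ≤ i → ∀ᵐ t ∂circleMeasure, Real.exp (2 * (u i t - u j t)) ≤ b t)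
    (hub' : ∀ j, ∀ᵐ t ∂circleMeasure, |u j t| ≤ b' t) :
    Tendsto (fun p : ℕ × ℕ => ∫ t, Real.exp (2 * (u p.1 t - u p.2 t)) ∂circleMeasure + 1
        - 2 * Real.exp (∫ t, (u p.1 t - u p.2 t) ∂circleMeasure))
      (atTop ⊓ 𝓟 {p | p.2 ≤ p.1}) (𝓝 0) := by
  have hsub : ∀ᵐ t ∂circleMeasure, Tendsto (fun p : ℕ × ℕ => u p.1 t - u p.2 t)
      (atTop ⊓ 𝓟 {p | p.2 ≤ p.1}) (𝓝 0) := by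
    filter_upwards [hlim] with t ht
    rw [← sub_self (u₀ t), ← prod_atTop_atTop_eq]
    exact ((ht.comp tendsto_fst).sub (ht.comp tendsto_snd)).mono_left inf_le_left
  have h1 : Tendsto (fun p : ℕ × ℕ => ∫ t, Real.exp (2 * (u p.1 t - u p.2 t)) ∂circleMeasure)
      (atTop ⊓ 𝓟 {p | p.2 ≤ p.1}) (𝓝 (∫ _t, (1 : ℝ) ∂circleMeasure)) := by
    refine tendsto_integral_filter_of_dominated_convergence b (Eventually.of_forall fun p =>
      Real.continuous_exp.comp_aestronglyMeasurable (((hu _).sub (hu _)).const_mul 2)) ?_ hb ?_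
    · rw [eventually_inf_principal]
      refine Eventually.of_forall fun p hp => ?_
      filter_upwards [hub p.1 p.2 hp] with t ht
      rwa [Real.norm_of_nonneg (Real.exp_pos _).le]
    · filter_upwards [hsub] with t ht
      have := (Real.continuous_exp.tendsto _).comp (ht.const_mul 2)
      simpa [Function.comp_def] using this
  have h2 : Tendsto (fun p : ℕ × ℕ => ∫ t, (u p.1 t - u p.2 t) ∂circleMeasure)
      (atTop ⊓ 𝓟 {p | p.2 ≤ p.1}) (𝓝 (∫ _t, (0 : ℝ) ∂circleMeasure)) := by
    refine tendsto_integral_filter_of_dominated_convergence (fun t => b' t + b' t)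
      (Eventually.of_forall fun p => (hu _).sub (hu _)) (Eventually.of_forall fun p => ?_)
      (hb'.add hb') hsub
    filter_upwards [hub' p.1, hub' p.2] with t h1 h2
    exact (norm_sub_le _ _).trans (add_le_add h1 h2)
  have h3 := (h1.add_const 1).sub (((Real.continuous_exp.tendsto _).comp h2).const_mul 2)
  convert h3 using 2
  simp; norm_num

/-- A sequence of bounded outer functions whose moduli converge in a dominated way has a
subsequence that converges almost everywhere. -/
theorem IsBoundedOuter.exists_subseq_tendsto {u : ℕ → UCircle → ℝ} {V : ℕ → UCircle → ℂ}
    {u₀ : UCircle → ℝ} {b b' : UCircle → ℝ} (hV : ∀ j, IsBoundedOuter (u j) (V j))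
    (hlim : ∀ᵐ t ∂circleMeasure, Tendsto (fun j => u j t) atTop (𝓝 (u₀ t)))
    (hb : Integrable b circleMeasure) (hb' : Integrable b' circleMeasure)
    (hub : ∀ i j, j ≤ i → ∀ᵐ t ∂circleMeasure, Real.exp (2 * (u i t - u j t)) ≤ b t)
    (hub' : ∀ j, ∀ᵐ t ∂circleMeasure, |u j t| ≤ b' t) :
    ∃ (φ : ℕ → ℕ) (V₀ : UCircle → ℂ), StrictMono φ ∧
      (∀ᵐ t ∂circleMeasure, Tendsto (fun k => V (φ k) t) atTop (𝓝 (V₀ t))) ∧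
      ∀ᵐ t ∂circleMeasure, ‖V₀ t‖ = Real.exp (u₀ t) := by
  have hE := tendsto_integral_exp_sub (fun j => (hV j).1) hlim hb hb' hub hub'
  have hev : ∀ n : ℕ, ∀ᶠ j in atTop, ∀ i, j ≤ i →
      ∫ t, ‖V i t * (V j t)⁻¹ - 1‖ ^ 2 ∂circleMeasure ≤ (1 / 4 : ℝ) ^ n := by
    intro n
    have h1 := hE.eventually (ge_mem_nhds (show (0 : ℝ) < (1 / 4) ^ n by positivity))
    rw [eventually_inf_principal, eventually_atTop] at h1
    obtain ⟨⟨a, c⟩, hac⟩ := h1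
    refine eventually_atTop.2 ⟨max a c, fun j hj i hi => ?_⟩
    rw [(hV i).integral_norm_div_sub_one_sq (hV j)]
    exact hac (i, j) ⟨(le_max_left a c).trans (hj.trans hi), (le_max_right a c).trans hj⟩ hi
  obtain ⟨φ, hφ, hφE⟩ := extraction_forall_of_eventually hev
  have hM : ∀ k, IsMultiplier (fun t => V (φ (k + 1)) t * (V (φ k) t)⁻¹ - 1) _ := fun k => by
    simpa only [sub_eq_add_neg] using
      ((hV (φ (k + 1))).isMultiplier.mul (hV (φ k)).isMultiplier_inv).add (.const (-1))
  have hsum := ae_summable_norm_of_integral_sq_le (fun k => by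
    obtain ⟨C, hC⟩ := (hM k).bounded
    refine (integrable_const (C ^ 2)).mono' ((hM k).1.norm.pow 2) ?_
    filter_upwards [hC] with t ht
    rw [Real.norm_of_nonneg (by positivity)]
    gcongr) (fun k => hφE k _ (hφ (Nat.lt_succ_self k)).le)
  have hnorm : ∀ᵐ t ∂circleMeasure, ∀ j, ‖V j t‖ = Real.exp (u j t) :=
    ae_all_iff.2 fun j => (hV j).norm_eq
  -- Increments factor as `V_k (V_{k+1} / V_k - 1)`; the first factor is bounded at `t` since `u j
  -- t` converges, and the second is summable.
  have hconv : ∀ᵐ t ∂circleMeasure, CauchySeq fun k => V (φ k) t := by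
    filter_upwards [hsum, hnorm, hlim] with t h1 h2 h3
    obtain ⟨C, hC⟩ := h3.bddAbove_range
    refine cauchySeq_of_summable_dist (.of_nonneg_of_le (fun _ => dist_nonneg) (fun k => ?_)
      (h1.mul_left (Real.exp C)))
    have h0 : V (φ k) t ≠ 0 := by
      rw [← norm_pos_iff, h2]
      exact Real.exp_pos _
    rw [dist_comm, dist_eq_norm, show V (φ (k + 1)) t - V (φ k) t =
      V (φ k) t * (V (φ (k + 1)) t * (V (φ k) t)⁻¹ - 1) by field_simp, norm_mul, h2]
    gcongr
    exact hC ⟨_, rfl⟩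
  have hlimV : ∀ᵐ t ∂circleMeasure, Tendsto (fun k => V (φ k) t) atTop
      (𝓝 (limUnder atTop fun k => V (φ k) t)) := by
    filter_upwards [hconv] with t ht using
      tendsto_nhds_limUnder (cauchySeq_tendsto_of_complete ht)
  refine ⟨φ, fun t => limUnder atTop fun k => V (φ k) t, hφ, ?_, ?_⟩
  · exact hlimV
  · filter_upwards [hlimV, hnorm, hlim] with t h1 h2 h3
    refine tendsto_nhds_unique h1.norm ?_
    simp only [h2]
    exact (Real.continuous_exp.tendsto _).comp (h3.comp hφ.tendsto_atTop)

/-! ### Existence of outer functions with bounded logarithmic modulus -/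

/-- The real part of a trigonometric polynomial is the real part of an analytic one. -/
theorem exists_isMultiplier_re_eq (q : C(UCircle, ℂ))
    (hq : q ∈ Submodule.span ℂ (Set.range (fourier (T := 2 * Real.pi)))) :
    ∃ (p : UCircle → ℂ) (c : ℝ), IsMultiplier p c ∧ ∀ t, (p t).re = (q t).re := by
  -- Taking real parts is not complex linear, so the induction over the span carries an arbitrary
  -- complex factor `a`.
  suffices ∀ a : ℂ, ∃ (p : UCircle → ℂ) (c : ℝ), IsMultiplier p c ∧
      ∀ t, (p t).re = (a * q t).re by simpa using this 1
  induction hq using Submodule.span_induction with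
  | mem q hq =>
    intro a
    obtain ⟨k, rfl⟩ := hq
    rcases lt_trichotomy k 0 with hk | rfl | hk
    -- A negative frequency is reflected to a positive one: conjugation leaves the real part
    -- unchanged.
    · refine ⟨_, 0, by simpa only [mul_zero, Complex.ofReal_zero] using
        (IsMultiplier.fourier_of_pos (k := -k) (by omega)).const_mul (starRingEnd ℂ a), fun t => ?_⟩
      rw [fourier_neg, ← map_mul, Complex.conj_re]
    -- The real constant `a.re` is taken instead of `a`, so that the value at the origin is real and
    -- its exponential positive.
    · exact ⟨_, a.re, .const _, fun t => by simp⟩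
    · exact ⟨_, 0, by simpa using (IsMultiplier.fourier_of_pos hk).const_mul a, fun t => rfl⟩
  | zero => exact fun a => ⟨_, 0, .const _, fun t => by simp⟩
  | add x y _ _ hx hy =>
    intro a
    obtain ⟨p, c, hp, hpe⟩ := hx a
    obtain ⟨p', c', hp', hpe'⟩ := hy a
    refine ⟨_, c + c', by simpa using hp.add hp', fun t => ?_⟩
    simp [hpe, hpe', mul_add]
  | smul b x _ hx =>
    intro a
    obtain ⟨p, c, hp, hpe⟩ := hx (a * b)
    exact ⟨p, c, hp, fun t => by rw [hpe]; simp [mul_assoc]⟩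

theorem IsMultiplier.isBoundedOuter_exp {p : UCircle → ℂ} {c : ℝ} (hp : IsMultiplier p c) :
    IsBoundedOuter (fun t => (p t).re) (fun t => Complex.exp (p t)) := by
  have hint : Integrable p circleMeasure := by simpa using (hp.isHOne_mul _ (.const 1)).1
  have hc : ∫ t, (p t).re ∂circleMeasure = c := by
    have h := hp.integral_mul _ (.const 1)
    simp only [one_mul, integral_const, probReal_univ, one_smul, mul_one] at h
    have h' := integral_re hint
    rw [h] at h'
    simpa using h'
  refine ⟨Complex.continuous_re.comp_aestronglyMeasurable hp.1, ?_,
    Eventually.of_forall fun t => Complex.norm_exp _, ?_, ?_⟩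
  · obtain ⟨C, hC⟩ := hp.bounded
    exact ⟨C, hC.mono fun t ht => (Complex.abs_re_le_norm _).trans ht⟩
  · rw [hc]
    simpa using hp.cexp
  · rw [hc]
    simpa [Complex.exp_neg] using (hp.const_mul (-1)).cexp

/-- Approximate `u` in `L¹` by a continuous function, clip it to `[-C, C]`, which does not increase
the distance to `u`, then approximate uniformly by a trigonometric polynomial and pass to an
analytic one with the same real part. -/
theorem exists_isMultiplier_approx {u : UCircle → ℝ} (hu : AEStronglyMeasurable u circleMeasure)
    {C : ℝ} (hC : ∀ t, |u t| ≤ C) {ε : ℝ} (hε : 0 < ε) :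
    ∃ (p : UCircle → ℂ) (c : ℝ), IsMultiplier p c ∧ (∀ t, |(p t).re| ≤ C + 1) ∧
      eLpNorm (fun t => (p t).re - u t) 1 circleMeasure ≤ ENNReal.ofReal ε := by
  have hC0 : 0 ≤ C := (abs_nonneg _).trans (hC 0)
  have hmem : MemLp u 1 circleMeasure :=
    memLp_one_iff_integrable.2 ((integrable_const C).mono' hu (Eventually.of_forall hC))
  obtain ⟨g, hg, -⟩ := hmem.exists_boundedContinuous_eLpNorm_sub_le ENNReal.one_ne_top
    (ε := ENNReal.ofReal (ε / 2)) (by simpa using hε)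
  let g' : C(UCircle, ℂ) :=
    ⟨fun t => ((max (-C) (min (g t) C) : ℝ) : ℂ), by fun_prop⟩
  have hcl : g' ∈ (Submodule.span ℂ
      (Set.range (fourier (T := 2 * Real.pi)))).topologicalClosure := by
    rw [span_fourier_closure_eq_top]
    trivial
  -- The bound `ε / 2` serves the `L¹` estimate; the bound `1` gives the uniform bound `C + 1`.
  obtain ⟨q, hq, hqd⟩ := Metric.mem_closure_iff.1 hcl (min (ε / 2) 1) (by positivity)
  obtain ⟨p, c, hp, hpq⟩ := exists_isMultiplier_re_eq q hq
  have hclose : ∀ t, |(p t).re - max (-C) (min (g t) C)| ≤ min (ε / 2) 1 := by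
    intro t
    have h1 : dist (g' t) (q t) ≤ min (ε / 2) 1 := (ContinuousMap.dist_apply_le_dist t).trans hqd.le
    rw [dist_comm, dist_eq_norm] at h1
    refine le_trans ?_ h1
    have h2 := Complex.abs_re_le_norm (q t - g' t)
    simpa [hpq, g'] using h2
  refine ⟨p, c, hp, fun t => ?_, ?_⟩
  · have h1 := (hclose t).trans (min_le_right _ _)
    have h2 : |max (-C) (min (g t) C)| ≤ C :=
      abs_le.2 ⟨le_max_left _ _, max_le (by linarith) (min_le_right _ _)⟩
    have h3 := abs_add_le ((p t).re - max (-C) (min (g t) C)) (max (-C) (min (g t) C))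
    rw [sub_add_cancel] at h3
    linarith
  · have hclip : ∀ t, |max (-C) (min (g t) C) - u t| ≤ |u t - g t| := by
      intro t
      have h := abs_le.1 (hC t)
      rw [abs_sub_comm]
      rcases le_total (g t) C with h1 | h1 <;> rcases le_total (-C) (g t) with h2 | h2
      · simp [h1, h2]
      · rw [min_eq_left h1, max_eq_left h2, abs_of_nonneg (by linarith), abs_of_nonneg (by linarith)]
        linarith
      · rw [min_eq_right h1, max_eq_right (by linarith), abs_of_nonpos (by linarith),
          abs_of_nonpos (by linarith)]
        linarith
      · have : C = 0 := by linarith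
        rw [min_eq_right h1, max_eq_right (by linarith), abs_of_nonpos (by linarith),
          abs_of_nonpos (by linarith)]
        linarith
    calc eLpNorm (fun t => (p t).re - u t) 1 circleMeasure
        ≤ eLpNorm ((fun _ => ε / 2) + fun t => ‖(u - ⇑g) t‖) 1 circleMeasure := by
          refine eLpNorm_mono_real fun t => ?_
          have h1 := (hclose t).trans (min_le_left _ _)
          have h2 := hclip t
          have h3 := abs_add_le ((p t).re - max (-C) (min (g t) C))
            (max (-C) (min (g t) C) - u t)
          rw [sub_add_sub_cancel] at h3
          simp only [Real.norm_eq_abs, Pi.add_apply, Pi.sub_apply]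
          linarith
      _ ≤ eLpNorm (fun _ => ε / 2) 1 circleMeasure +
          eLpNorm (fun t => ‖(u - ⇑g) t‖) 1 circleMeasure :=
          eLpNorm_add_le aestronglyMeasurable_const
            (hu.sub g.continuous.aestronglyMeasurable).norm le_rfl
      _ ≤ ENNReal.ofReal (ε / 2) + ENNReal.ofReal (ε / 2) := by
          rw [eLpNorm_norm]
          refine add_le_add ?_ hg
          rw [eLpNorm_const _ one_ne_zero (IsProbabilityMeasure.ne_zero _)]
          simp [Real.enorm_eq_ofReal_abs, abs_of_pos (half_pos hε)]
      _ = ENNReal.ofReal ε := by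
          rw [← ENNReal.ofReal_add (by positivity) (by positivity), add_halves]

/-- Exponentials of the approximants are outer, and their log moduli converge a.e. to `u` along a
subsequence. A further subsequence of the exponentials converges a.e.; the uniform bound on the real
parts bounds them and their inverses, so both limits are multipliers. -/
theorem exists_isBoundedOuter {u : UCircle → ℝ} (hu : AEStronglyMeasurable u circleMeasure)
    {C : ℝ} (hC : ∀ t, |u t| ≤ C) : ∃ V, IsBoundedOuter u V := by
  choose p c hp hpC hpu using fun j : ℕ =>
    exists_isMultiplier_approx hu hC (ε := 1 / ((j : ℝ) + 1)) (by positivity)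
  have hL : Tendsto (fun j => eLpNorm ((fun t => (p j t).re) - u) 1 circleMeasure) atTop (𝓝 0) := by
    refine tendsto_of_tendsto_of_tendsto_of_le_of_le tendsto_const_nhds ?_
      (fun _ => zero_le) hpu
    simpa using ENNReal.tendsto_ofReal tendsto_one_div_add_atTop_nhds_zero_nat
  obtain ⟨ψ, hψ, hψlim⟩ := (tendstoInMeasure_of_tendsto_eLpNorm one_ne_zero
    (fun j => (hp j).isBoundedOuter_exp.1) hu hL).exists_seq_tendsto_ae
  have hout := fun j => (hp (ψ j)).isBoundedOuter_exp
  have hbd : ∀ j, ∀ᵐ t ∂circleMeasure, |(p (ψ j) t).re| ≤ C + 1 :=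
    fun j => Eventually.of_forall (hpC _)
  obtain ⟨φ, V, hφ, hV, hVn⟩ := IsBoundedOuter.exists_subseq_tendsto hout hψlim
    (integrable_const (Real.exp (2 * (2 * (C + 1))))) (integrable_const (C + 1))
    (fun i j _ => Eventually.of_forall fun t => by
      have h1 := abs_le.1 (hpC (ψ i) t)
      have h2 := abs_le.1 (hpC (ψ j) t)
      rw [Real.exp_le_exp]
      linarith) hbd
  have hint : Tendsto (fun k => ∫ t, (p (ψ (φ k)) t).re ∂circleMeasure) atTop
      (𝓝 (∫ t, u t ∂circleMeasure)) := by
    refine (tendsto_integral_of_dominated_convergence _ (fun j => (hout j).1)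
      (integrable_const (C + 1)) hbd hψlim).comp hφ.tendsto_atTop
  refine ⟨V, hu, ⟨C, Eventually.of_forall hC⟩, hVn, ?_, ?_⟩
  · refine .of_tendsto (C := Real.exp (C + 1)) (fun k => (hout (φ k)).isMultiplier)
      (fun k => Eventually.of_forall fun t => ?_) hV ?_
    · rw [Complex.norm_exp, Real.exp_le_exp]
      exact (le_abs_self _).trans (hpC _ t)
    · exact (Complex.continuous_ofReal.tendsto _).comp ((Real.continuous_exp.tendsto _).comp hint)
  · refine .of_tendsto (C := Real.exp (C + 1)) (fun k => (hout (φ k)).isMultiplier_inv)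
      (fun k => Eventually.of_forall fun t => ?_) ?_ ?_
    · rw [norm_inv, Complex.norm_exp, ← Real.exp_neg, Real.exp_le_exp]
      exact (neg_le_abs _).trans (hpC _ t)
    · filter_upwards [hV, hVn] with t h1 h2
      refine h1.inv₀ ?_
      rw [← norm_pos_iff, h2]
      exact Real.exp_pos _
    · exact (Complex.continuous_ofReal.tendsto _).comp
        ((Real.continuous_exp.tendsto _).comp hint.neg)

/-! ### Outer functions with modulus `w`, for `w` and `1/w` integrable -/

/-- Yields an integrable majorant for `log w` when `w` and `1/w` are integrable. -/
theorem abs_log_le_add_inv {x : ℝ} (hx : 0 ≤ x) : |Real.log x| ≤ x + x⁻¹ := by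
  have h1 := Real.log_le_self hx
  have h2 := Real.log_le_self (inv_nonneg.2 hx)
  rw [Real.log_inv] at h2
  exact abs_le.2 ⟨by linarith, by linarith [inv_nonneg.2 hx]⟩

/-- Truncation of a real number to the interval `[-N, N]`. -/
noncomputable def realTrunc (N : ℕ) (x : ℝ) : ℝ := max (-N : ℝ) (min x N)

theorem continuous_realTrunc (N : ℕ) : Continuous (realTrunc N) := by
  unfold realTrunc
  fun_prop

theorem abs_realTrunc_le (N : ℕ) (x : ℝ) : |realTrunc N x| ≤ N :=
  abs_le.2 ⟨le_max_left _ _, max_le (by linarith [(Nat.cast_nonneg N : (0 : ℝ) ≤ N)])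
    (min_le_right _ _)⟩

theorem realTrunc_le_max (N : ℕ) (x : ℝ) : realTrunc N x ≤ max 0 x := by
  refine max_le ?_ ((min_le_left _ _).trans (le_max_right _ _))
  exact (neg_nonpos.2 (Nat.cast_nonneg N)).trans (le_max_left _ _)

theorem neg_realTrunc (N : ℕ) (x : ℝ) : -realTrunc N x = realTrunc N (-x) := by
  have hN : (0 : ℝ) ≤ N := Nat.cast_nonneg N
  simp only [realTrunc, ← min_neg_neg, ← max_neg_neg, neg_neg]
  rcases le_total x (-N) with h1 | h1 <;> rcases le_total x N with h2 | h2 <;>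
    simp [max_def, min_def] <;> split_ifs <;> linarith

theorem abs_realTrunc_le_abs (N : ℕ) (x : ℝ) : |realTrunc N x| ≤ |x| := by
  refine abs_le'.2 ⟨(realTrunc_le_max N x).trans (max_le (abs_nonneg x) (le_abs_self x)), ?_⟩
  rw [neg_realTrunc]
  exact (realTrunc_le_max N _).trans (max_le (abs_nonneg x) (neg_le_abs x))

/-- Raising the level moves the truncation away from zero, so the difference is nonpositive for `x ≤
0` and at most `x` otherwise. -/
theorem realTrunc_sub_le {M N : ℕ} (h : M ≤ N) (x : ℝ) :
    realTrunc N x - realTrunc M x ≤ max 0 x := by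
  have hMN : (M : ℝ) ≤ N := Nat.cast_le.2 h
  have hM : (0 : ℝ) ≤ M := Nat.cast_nonneg M
  rcases le_total 0 x with hx | hx
  · have h1 := realTrunc_le_max N x
    have h2 : 0 ≤ realTrunc M x := le_max_of_le_right (le_min hx hM)
    linarith
  · have h1 : realTrunc N x ≤ realTrunc M x := by
      unfold realTrunc
      rw [min_eq_left (by linarith), min_eq_left (by linarith)]
      exact max_le_max (by linarith) le_rfl
    linarith [le_max_left 0 x]

theorem tendsto_realTrunc (x : ℝ) : Tendsto (fun N => realTrunc N x) atTop (𝓝 x) := by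
  obtain ⟨N, hN⟩ := exists_nat_ge |x|
  refine tendsto_atTop_of_eventually_const (i₀ := N) fun M hM => ?_
  have h : |x| ≤ M := hN.trans (Nat.cast_le.2 hM)
  rw [abs_le] at h
  rw [realTrunc, min_eq_left h.2, max_eq_right h.1]

theorem exp_two_mul_max_zero_le (x : ℝ) :
    Real.exp (2 * max 0 x) ≤ 1 + Real.exp (2 * x) := by
  rcases le_total 0 x with hx | hx
  · rw [max_eq_right hx]; linarith
  · rw [max_eq_left hx]; simpa using (Real.exp_pos _).le

/-- The outer function with a given modulus `w`, where `w` and `1/w` are integrable: multiplication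
and division by it stay within `H¹` whenever the result is integrable. -/
structure IsOuter (w : UCircle → ℝ) (W : UCircle → ℂ) : Prop where
  aestronglyMeasurable : AEStronglyMeasurable W circleMeasure
  norm_eq : ∀ᵐ t ∂circleMeasure, ‖W t‖ = w t
  ne_zero : ∀ᵐ t ∂circleMeasure, W t ≠ 0
  isHOne_mul : ∀ f, IsHOne f → Integrable (fun t => f t * W t) circleMeasure →
    IsHOne (fun t => f t * W t)
  isHOne_mul_inv : ∀ f, IsHOne f → Integrable (fun t => f t * (W t)⁻¹) circleMeasure →
    IsHOne (fun t => f t * (W t)⁻¹)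

/-- Truncate `½ log w`, take bounded outer functions `V N` for the truncations, extract an a.e.
limit `V₀`, and put `W = V₀²`. -/
theorem exists_isOuter {w : UCircle → ℝ} (hpos : ∀ᵐ t ∂circleMeasure, 0 < w t)
    (hw : Integrable w circleMeasure) (hw' : Integrable (fun t => (w t)⁻¹) circleMeasure) :
    ∃ W, IsOuter w W := by
  -- The factor one half is needed because the convergence argument requires `exp (2 u)` to be
  -- integrable; here this is `w` itself rather than `w²`.
  set u : UCircle → ℝ := fun t => 2⁻¹ * Real.log (w t) with hu
  have hum : AEStronglyMeasurable u circleMeasure :=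
    (Real.measurable_log.comp_aemeasurable hw.1.aemeasurable).aestronglyMeasurable.const_mul _
  have hexp : ∀ᵐ t ∂circleMeasure, Real.exp (2 * u t) = w t := by
    filter_upwards [hpos] with t ht
    rw [hu]
    simp [Real.exp_log ht]
  choose V hV using fun N : ℕ =>
    exists_isBoundedOuter ((continuous_realTrunc N).comp_aestronglyMeasurable hum)
      fun t => abs_realTrunc_le N (u t)
  have hlim : ∀ᵐ t ∂circleMeasure, Tendsto (fun N => realTrunc N (u t)) atTop (𝓝 (u t)) :=
    Eventually.of_forall fun t => tendsto_realTrunc _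
  obtain ⟨φ, V₀, hφ, hV₀, hV₀n⟩ := IsBoundedOuter.exists_subseq_tendsto hV hlim
    (b := fun t => 1 + w t) (b' := fun t => w t + (w t)⁻¹)
    ((integrable_const 1).add hw) (hw.add hw')
    (fun i j hij => by
      filter_upwards [hexp] with t ht
      rw [← ht]
      refine le_trans ?_ (exp_two_mul_max_zero_le _)
      rw [Real.exp_le_exp]
      linarith [realTrunc_sub_le hij (u t)])
    (fun j => by
      filter_upwards [hpos] with t ht
      refine (abs_realTrunc_le_abs _ _).trans ?_
      have h := abs_log_le_add_inv ht.le
      have h0 := abs_nonneg (Real.log (w t))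
      rw [hu]
      simp only [abs_mul]
      rw [abs_of_pos (by norm_num : (0 : ℝ) < 2⁻¹)]
      linarith)
  have hV₀0 : ∀ᵐ t ∂circleMeasure, V₀ t ≠ 0 := by
    filter_upwards [hV₀n] with t ht
    rw [← norm_pos_iff, ht]
    exact Real.exp_pos _
  have hVn : ∀ᵐ t ∂circleMeasure, ∀ N, ‖V N t‖ = Real.exp (realTrunc N (u t)) :=
    ae_all_iff.2 fun N => (hV N).norm_eq
  have hnorm : ∀ᵐ t ∂circleMeasure, ‖V₀ t ^ 2‖ = w t := by
    filter_upwards [hV₀n, hexp] with t h1 h2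
    rw [norm_pow, h1, ← Real.exp_nat_mul, ← h2]
    norm_num
  refine ⟨fun t => V₀ t ^ 2, ?_, hnorm, hV₀0.mono fun t ht => pow_ne_zero 2 ht, ?_, ?_⟩
  · exact (aestronglyMeasurable_of_tendsto_ae atTop (fun k => (hV (φ k)).isMultiplier.1) hV₀).pow 2
  · intro f hf hfi
    -- Truncation gives `‖V N‖² ≤ 1 + w`, so integrability of `f` and of `f W` is all the domination
    -- needs. The inverse case is the same with `1/w`.
    refine .of_dominated_limit (F := fun k t => f t * V (φ k) t ^ 2)
      (b := fun t => ‖f t‖ + ‖f t * V₀ t ^ 2‖)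
      (fun k => ((hV (φ k)).isMultiplier.pow 2).isHOne_mul f hf) (hf.1.norm.add hfi.norm)
      (fun k => ?_) ?_
    · filter_upwards [hVn, hnorm, hexp] with t h1 h2 h3
      rw [norm_mul, norm_mul, h2, norm_pow, h1, ← Real.exp_nat_mul, ← mul_one_add, ← h3]
      gcongr
      refine le_trans ?_ (exp_two_mul_max_zero_le _)
      rw [Real.exp_le_exp]
      push_cast
      linarith [realTrunc_le_max (φ k) (u t)]
    · filter_upwards [hV₀] with t ht
      exact (ht.pow 2).const_mul _
  · intro f hf hfi
    refine .of_dominated_limit (F := fun k t => f t * (V (φ k) t)⁻¹ ^ 2)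
      (b := fun t => ‖f t‖ + ‖f t * (V₀ t ^ 2)⁻¹‖)
      (fun k => ((hV (φ k)).isMultiplier_inv.pow 2).isHOne_mul f hf) (hf.1.norm.add hfi.norm)
      (fun k => ?_) ?_
    · filter_upwards [hVn, hnorm, hexp] with t h1 h2 h3
      rw [norm_mul, norm_mul, norm_inv, h2, norm_pow, norm_inv, h1, ← Real.exp_neg,
        ← Real.exp_nat_mul, ← mul_one_add, ← h3, ← Real.exp_neg]
      gcongr
      rw [← mul_neg]
      refine le_trans ?_ (exp_two_mul_max_zero_le _)
      rw [Real.exp_le_exp, neg_realTrunc]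
      push_cast
      linarith [realTrunc_le_max (φ k) (-u t)]
    · filter_upwards [hV₀, hV₀0] with t ht h0
      rw [← inv_pow]
      exact ((ht.inv₀ h0).pow 2).const_mul _

/-! ### Products of `H^∞` and `H¹` functions -/

/-- Parseval writes the coefficient of index `n` as `∑ ĥ(n - i) ĝ(i)`. For `n < 0`, one of the
indices `i`, `n - i` is always negative, so every term vanishes. -/
theorem IsHOne.mul_of_memLp_two {g h : UCircle → ℂ} (hg : IsHOne g) (hh : IsHOne h)
    (hg2 : MemLp g 2 circleMeasure) (hh2 : MemLp h 2 circleMeasure) :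
    IsHOne (fun t => h t * g t) := by
  refine ⟨MemLp.integrable_mul hh2 hg2, fun n hn => ?_⟩
  set k : UCircle → ℂ := fun t => starRingEnd ℂ (h t * fourier (-n) t) with hk
  have hk2 : MemLp k 2 circleMeasure := by
    refine hh2.of_le (continuous_star.comp_aestronglyMeasurable
      (hh2.1.mul (aestronglyMeasurable_fourier _))) (Eventually.of_forall fun t => ?_)
    rw [hk]
    simp only [RCLike.norm_conj, norm_mul, norm_fourier_apply, mul_one, le_refl]
  have hsum := (fourierBasis (T := 2 * Real.pi)).hasSum_inner_mul_inner (hk2.toLp k) (hg2.toLp g)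
  have hterm : ∀ i : ℤ, inner ℂ (hk2.toLp k) (fourierBasis (T := 2 * Real.pi) i) *
      inner ℂ (fourierBasis (T := 2 * Real.pi) i) (hg2.toLp g) = 0 := by
    intro i
    rw [← HilbertBasis.repr_apply_apply, fourierBasis_repr,
      fourierCoeff_congr_ae hg2.coeFn_toLp]
    rcases lt_or_ge i 0 with hi | hi
    · rw [hg.2 i hi, mul_zero]
    · rw [← inner_conj_symm, ← HilbertBasis.repr_apply_apply, fourierBasis_repr,
        fourierCoeff_congr_ae hk2.coeFn_toLp]
      have : starRingEnd ℂ (fourierCoeff k i) = fourierCoeff h (n - i) := by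
        rw [fourierCoeff, ← integral_conj, fourierCoeff]
        congr 1 with t
        rw [show -(n - i) = i + -n by ring, fourier_add, hk, smul_eq_mul, smul_eq_mul, map_mul,
          Complex.conj_conj, ← fourier_neg, neg_neg]
        ring
      rw [this, hh.2 _ (by omega), zero_mul]
  simp only [hterm] at hsum
  have h0 := hsum.unique hasSum_zero
  rw [L2.inner_def] at h0
  rw [fourierCoeff, ← h0]
  refine integral_congr_ae ?_
  filter_upwards [hk2.coeFn_toLp, hg2.coeFn_toLp] with t h1 h2
  rw [h1, h2, RCLike.inner_apply, hk, Complex.conj_conj, smul_eq_mul]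
  ring

theorem MemHInfty.isHOne {h : UCircle → ℂ} (hh : MemHInfty h) : IsHOne h :=
  ⟨hh.1.integrable le_top, hh.2⟩

theorem MemHInfty.exists_bound {h : UCircle → ℂ} (hh : MemHInfty h) :
    ∃ C : ℝ≥0, ∀ᵐ t ∂circleMeasure, ‖h t‖ ≤ C := by
  have h1 := hh.1.2
  rw [eLpNorm_exponent_top] at h1
  refine ⟨(eLpNormEssSup h circleMeasure).toNNReal, ?_⟩
  filter_upwards [enorm_ae_le_eLpNormEssSup h circleMeasure] with t ht
  rw [← ENNReal.coe_toNNReal h1.ne, enorm_eq_nnnorm] at ht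
  exact_mod_cast ht

/-- Dividing `f` by the outer function of modulus `max 1 ‖f‖` gives a quotient bounded by `1`. The
square integrable case applies to its product with `h`, and multiplying back by the outer function
is allowed since `h f` is integrable. -/
theorem MemHInfty.isHOne_mul {f h : UCircle → ℂ} (hh : MemHInfty h) (hf : IsHOne f) :
    IsHOne (fun t => h t * f t) := by
  obtain ⟨C, hC⟩ := hh.exists_bound
  have hhf : Integrable (fun t => h t * f t) circleMeasure := hf.1.bdd_mul hh.1.1 hC
  have hw1 : ∀ t, (1 : ℝ) ≤ max 1 ‖f t‖ := fun t => le_max_left _ _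
  have hwi : Integrable (fun t => max 1 ‖f t‖) circleMeasure := (integrable_const 1).sup hf.1.norm
  obtain ⟨W, hW⟩ := exists_isOuter (Eventually.of_forall fun t => one_pos.trans_le (hw1 t)) hwi
    ((integrable_const (1 : ℝ)).mono' hwi.1.aemeasurable.inv.aestronglyMeasurable
      (Eventually.of_forall fun t => by
        rw [norm_inv, Real.norm_of_nonneg (zero_le_one.trans (hw1 t))]
        exact inv_le_one_of_one_le₀ (hw1 t)))
  have hgm : AEStronglyMeasurable (fun t => f t * (W t)⁻¹) circleMeasure :=
    hf.1.1.mul hW.1.inv₀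
  have hgb : ∀ᵐ t ∂circleMeasure, ‖f t * (W t)⁻¹‖ ≤ 1 := by
    filter_upwards [hW.norm_eq] with t ht
    rw [norm_mul, norm_inv, ht, ← div_eq_mul_inv]
    exact div_le_one_of_le₀ (le_max_right _ _) (zero_le_one.trans (hw1 t))
  have hg := hW.isHOne_mul_inv f hf ((integrable_const 1).mono' hgm hgb)
  have hprod := hg.mul_of_memLp_two hh.isHOne (.of_bound hgm 1 hgb) (hh.1.mono_exponent le_top)
  have hcancel : (fun t => h t * (f t * (W t)⁻¹) * W t) =ᵐ[circleMeasure] fun t => h t * f t := by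
    filter_upwards [hW.ne_zero] with t ht
    field_simp
  exact (hW.isHOne_mul _ hprod (hhf.congr hcancel.symm)).congr_ae hcancel

/-! ### The truncated Cauchy integral of an `H¹` function -/

theorem measurableSet_lt_norm_circlePt_sub (t : UCircle) (ε : ℝ) :
    MeasurableSet {s : UCircle | ε < ‖circlePt s - circlePt t‖} :=
  measurableSet_lt measurable_const (continuous_circlePt.sub continuous_const).norm.measurable

theorem measurableSet_norm_circlePt_sub_le (t : UCircle) (ε : ℝ) :
    MeasurableSet {s : UCircle | ‖circlePt s - circlePt t‖ ≤ ε} :=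
  measurableSet_le (continuous_circlePt.sub continuous_const).norm.measurable measurable_const

theorem truncatedCauchy_eq (f : UCircle → ℂ) (t : UCircle) (ε : ℝ) :
    truncatedCauchy f t ε = 2 * ∫ s in {s : UCircle | ε < ‖circlePt s - circlePt t‖},
      f s * (circlePt s / (circlePt s - circlePt t)) ∂circleMeasure := by
  rw [truncatedCauchy, ← integral_const_mul, ← integral_const_mul]
  congr 1 with s
  have : (Real.pi : ℂ) ≠ 0 := by exact_mod_cast Real.pi_ne_zero
  field_simp

theorem aestronglyMeasurable_cauchyKernel (a : ℂ) (μ : Measure UCircle) :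
    AEStronglyMeasurable (fun s => circlePt s / (circlePt s - a)) μ :=
  (continuous_circlePt.measurable.div
    (continuous_circlePt.sub continuous_const).measurable).aestronglyMeasurable

theorem integrableOn_mul_cauchyKernel {f : UCircle → ℂ} (hf : Integrable f circleMeasure)
    (t : UCircle) {ε : ℝ} (hε : 0 < ε) :
    IntegrableOn (fun s => f s * (circlePt s / (circlePt s - circlePt t)))
      {s : UCircle | ε < ‖circlePt s - circlePt t‖} circleMeasure := by
  refine hf.integrableOn.mul_bdd (c := ε⁻¹) (aestronglyMeasurable_cauchyKernel _ _) ?_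
  filter_upwards [ae_restrict_mem (measurableSet_lt_norm_circlePt_sub t ε)] with s hs
  rw [norm_div, norm_circlePt, one_div]
  exact inv_anti₀ hε (le_of_lt hs)

theorem HasCauchySingularIntegral.add {f g : UCircle → ℂ} {t : UCircle} {x y : ℂ}
    (hfi : Integrable f circleMeasure) (hgi : Integrable g circleMeasure)
    (hf : HasCauchySingularIntegral f t x) (hg : HasCauchySingularIntegral g t y) :
    HasCauchySingularIntegral (fun s => f s + g s) t (x + y) := by
  refine (Tendsto.add hf hg).congr' ?_
  filter_upwards [self_mem_nhdsWithin] with ε hε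
  rw [truncatedCauchy_eq, truncatedCauchy_eq, truncatedCauchy_eq, ← mul_add,
    ← integral_add (integrableOn_mul_cauchyKernel hfi t hε)
      (integrableOn_mul_cauchyKernel hgi t hε)]
  simp only [add_mul]

theorem HasCauchySingularIntegral.const_mul {f : UCircle → ℂ} {t : UCircle} {x : ℂ}
    (hf : HasCauchySingularIntegral f t x) (c : ℂ) :
    HasCauchySingularIntegral (fun s => c * f s) t (c * x) := by
  refine (Tendsto.const_mul c hf).congr fun ε => ?_
  rw [truncatedCauchy_eq, truncatedCauchy_eq, mul_left_comm, ← integral_const_mul]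
  simp only [mul_assoc]

theorem HasCauchySingularIntegral.sum {ι : Type*} (s : Finset ι) {f : ι → UCircle → ℂ}
    {t : UCircle} {x : ι → ℂ} (hfi : ∀ i ∈ s, Integrable (f i) circleMeasure)
    (hf : ∀ i ∈ s, HasCauchySingularIntegral (f i) t (x i)) :
    HasCauchySingularIntegral (fun r => ∑ i ∈ s, f i r) t (∑ i ∈ s, x i) := by
  classical
  induction s using Finset.induction_on with
  | empty =>
    refine (tendsto_const_nhds (x := (0 : ℂ))).congr fun ε => ?_
    simp [truncatedCauchy]
  | insert a s ha ih =>
    simp only [Finset.sum_insert ha]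
    exact .add (hfi a (Finset.mem_insert_self _ _))
      (integrable_finsetSum s fun i hi => hfi i (Finset.mem_insert_of_mem hi))
      (hf a (Finset.mem_insert_self _ _)) (ih (fun i hi => hfi i (Finset.mem_insert_of_mem hi))
        fun i hi => hf i (Finset.mem_insert_of_mem hi))

theorem HasCauchySingularIntegral.congr_ae {f g : UCircle → ℂ} {t : UCircle} {x : ℂ}
    (hf : HasCauchySingularIntegral f t x) (h : f =ᵐ[circleMeasure] g) :
    HasCauchySingularIntegral g t x := by
  refine Tendsto.congr (fun ε => ?_) hf
  rw [truncatedCauchy_eq, truncatedCauchy_eq]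
  congr 1
  refine integral_congr_ae (ae_restrict_of_ae ?_)
  filter_upwards [h] with s hs
  rw [hs]

/-- The Cauchy integral of an `H¹` function vanishes outside the closed unit disc. -/
theorem IsHOne.integral_cauchy_exterior {H : UCircle → ℂ} (hH : IsHOne H) (t : UCircle) {r : ℝ}
    (hr : 1 < r) :
    ∫ s, H s * (circlePt s / (circlePt s - r * circlePt t)) ∂circleMeasure = 0 := by
  have hr0 : (r : ℂ) ≠ 0 := by
    exact_mod_cast (zero_lt_one.trans hr).ne'
  have ht0 := circlePt_ne_zero t
  have hq0 : 0 ≤ r⁻¹ := inv_nonneg.2 (zero_le_one.trans hr.le)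
  have hq1 : r⁻¹ < 1 := inv_lt_one_of_one_lt₀ hr
  have hx : ∀ s, ‖circlePt s / (r * circlePt t)‖ = r⁻¹ := fun s => by
    rw [norm_div, norm_mul, norm_circlePt, norm_circlePt, mul_one, Complex.norm_real,
      Real.norm_of_nonneg (zero_le_one.trans hr.le), one_div]
  -- Geometric expansion of the kernel in powers of `s / (r t)`, of modulus `1/r < 1`. The terms
  -- integrate to multiples of the coefficients of `H` of index `-(k + 1)`.
  set F : ℕ → UCircle → ℂ :=
    fun k s => (-((r * circlePt t)⁻¹ ^ (k + 1))) * (H s * fourier (k + 1 : ℤ) s) with hF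
  have hFx : ∀ k s, F k s = -H s * (circlePt s / (r * circlePt t)) ^ (k + 1) := fun k s => by
    rw [hF]
    simp only [fourier_eq_circlePt_zpow, div_eq_mul_inv, mul_pow]
    norm_cast
    ring
  have hFi : ∀ k, Integrable (F k) circleMeasure := fun k =>
    (hH.1.mul_fourier _).const_mul _
  have hFn : ∀ k, ∫ s, ‖F k s‖ ∂circleMeasure = (∫ s, ‖H s‖ ∂circleMeasure) * r⁻¹ ^ (k + 1) := by
    intro k
    rw [← integral_mul_const]
    congr 1 with s
    rw [hFx, norm_mul, norm_neg, norm_pow, hx]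
  have hsum := hasSum_integral_of_summable_integral_norm hFi (by
    simp only [hFn]
    exact (((summable_nat_add_iff 1).2 (summable_geometric_of_lt_one hq0 hq1))).mul_left _)
  have hF0 : ∀ k, ∫ s, F k s ∂circleMeasure = 0 := fun k => by
    rw [hF]
    simp only
    rw [integral_const_mul, ← fourierCoeff_zero_eq_integral, fourierCoeff_mul_fourier,
      hH.2 _ (by omega), mul_zero]
  simp only [hF0] at hsum
  rw [← hsum.unique hasSum_zero]
  congr 1 with s
  simp only [hFx]
  rw [tsum_mul_left]
  simp only [pow_succ]
  rw [tsum_mul_right, tsum_geometric_of_norm_lt_one (by rw [hx]; exact hq1)]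
  have h1 : (1 : ℂ) - circlePt s / (r * circlePt t) ≠ 0 := by
    intro h
    have h2 := hx s
    rw [← sub_eq_zero.1 h, norm_one] at h2
    exact hq1.ne h2.symm
  have h2 : r * circlePt t - circlePt s ≠ 0 := by
    intro h
    apply h1
    rw [← sub_eq_zero.1 h, div_self (mul_ne_zero hr0 ht0), sub_self]
  have h3 : circlePt s - r * circlePt t ≠ 0 := by
    rw [← neg_ne_zero, neg_sub]
    exact h2
  have h4 : (1 : ℂ) - circlePt s / (r * circlePt t) =
      -(circlePt s - r * circlePt t) / (r * circlePt t) := by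
    field_simp
    ring
  rw [h4]
  field_simp

theorem norm_circlePt_sub_le (s t : UCircle) {r : ℝ} (hr : 1 ≤ r) :
    ‖circlePt s - circlePt t‖ ≤ ‖circlePt s - r * circlePt t‖ := by
  have hs := norm_circlePt s
  have ht := norm_circlePt t
  set a := circlePt s
  set b := circlePt t
  have hre : (a * starRingEnd ℂ b).re ≤ 1 :=
    (Complex.re_le_norm _).trans (by rw [norm_mul, RCLike.norm_conj, hs, ht, mul_one])
  rw [← sq_le_sq₀ (norm_nonneg _) (norm_nonneg _), Complex.sq_norm, Complex.sq_norm,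
    Complex.normSq_sub, Complex.normSq_sub, map_mul, map_mul, Complex.conj_ofReal,
    show a * (r * starRingEnd ℂ b) = r * (a * starRingEnd ℂ b) by ring, Complex.re_ofReal_mul,
    Complex.normSq_ofReal, ← Complex.sq_norm, ← Complex.sq_norm, hs, ht]
  nlinarith

theorem sub_one_le_norm_circlePt_sub (s t : UCircle) {r : ℝ} (hr : 1 ≤ r) :
    r - 1 ≤ ‖circlePt s - r * circlePt t‖ := by
  have h := norm_sub_norm_le (r * circlePt t) (circlePt s)
  rwa [norm_mul, norm_circlePt, norm_circlePt, mul_one, Complex.norm_real,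
    Real.norm_of_nonneg (by linarith), norm_sub_rev] at h

/-- The mean `δ⁻¹ ∫_{|s - t| ≤ δ} |H| dm`. -/
noncomputable def chordMean (H : UCircle → ℂ) (t : UCircle) (δ : ℝ) : ℝ :=
  δ⁻¹ * ∫ s in {s : UCircle | ‖circlePt s - circlePt t‖ ≤ δ}, ‖H s‖ ∂circleMeasure

/-- The two kernels differ by `ε / (|s - t| |s - (1 + ε) t|)` in modulus away from `t`, and the
truncated one is zero near `t`. On dyadic annuli around `t` this decays like `4^(-k) / ε`, so one
term of the series already suffices at each `s`. -/
theorem enorm_indicator_cauchyKernel_sub_le (t s : UCircle) {ε : ℝ} (hε : 0 < ε) :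
    ‖{s : UCircle | ε < ‖circlePt s - circlePt t‖}.indicator
        (fun s => circlePt s / (circlePt s - circlePt t)) s -
        circlePt s / (circlePt s - (1 + ε : ℝ) * circlePt t)‖ₑ ≤
      ∑' k : ℕ, {s : UCircle | ‖circlePt s - circlePt t‖ ≤ 2 ^ k * ε}.indicator
        (fun _ => ENNReal.ofReal (4 / ε * (1 / 4) ^ k)) s := by
  set d := ‖circlePt s - circlePt t‖ with hd
  have h1 := norm_circlePt_sub_le s t (r := 1 + ε) (by linarith)
  have h2 := sub_one_le_norm_circlePt_sub s t (r := 1 + ε) (by linarith)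
  rw [← hd] at h1
  rcases le_or_gt d ε with hde | hde
  · refine le_trans ?_ (ENNReal.le_tsum 0)
    rw [Set.indicator_of_notMem (by simpa using hde), Set.indicator_of_mem (by simpa using hde),
      zero_sub, enorm_neg, ← ofReal_norm, norm_div, norm_circlePt]
    refine ENNReal.ofReal_le_ofReal ?_
    rw [pow_zero, mul_one]
    exact div_le_div₀ (by norm_num) (by norm_num) hε (by linarith)
  · obtain ⟨n, hn1, hn2⟩ := exists_nat_pow_near (x := d / ε) (y := (2 : ℝ))
      ((one_le_div hε).2 hde.le) one_lt_two
    rw [le_div_iff₀ hε] at hn1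
    rw [div_lt_iff₀ hε] at hn2
    -- For `2^n ε ≤ d < 2^(n+1) ε` the smallest dyadic disc sure to contain `s` has index `n + 1`;
    -- this shift accounts for the constant `4`.
    refine le_trans ?_ (ENNReal.le_tsum (n + 1))
    rw [Set.indicator_of_mem (by simpa using hde), Set.indicator_of_mem (by simpa using hn2.le),
      ← ofReal_norm]
    refine ENNReal.ofReal_le_ofReal ?_
    have hd0 : 0 < d := hε.trans hde
    have e1 : circlePt s - circlePt t ≠ 0 := norm_pos_iff.1 hd0
    have e2 : circlePt s - (1 + ε : ℝ) * circlePt t ≠ 0 := norm_pos_iff.1 (hd0.trans_le h1)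
    have e3 : circlePt s / (circlePt s - circlePt t) -
        circlePt s / (circlePt s - (1 + ε : ℝ) * circlePt t) =
        -(circlePt s * ε * circlePt t) /
          ((circlePt s - circlePt t) * (circlePt s - (1 + ε : ℝ) * circlePt t)) := by
      rw [div_sub_div _ _ e1 e2]
      congr 1
      push_cast
      ring
    rw [e3, norm_div, norm_neg, norm_mul, norm_mul, norm_mul, norm_circlePt, norm_circlePt,
      Complex.norm_real, Real.norm_of_nonneg hε.le, one_mul, mul_one, ← hd]
    have hp : (0 : ℝ) < 2 ^ n * ε := by positivity
    calc ε / (d * ‖circlePt s - (1 + ε : ℝ) * circlePt t‖)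
        ≤ ε / ((2 ^ n * ε) * (2 ^ n * ε)) := by
          gcongr
          exact hn1.trans h1
      _ = 4 / ε * (1 / 4) ^ (n + 1) := by
          have h4 : (4 : ℝ) ^ n = 2 ^ n * 2 ^ n := by rw [← mul_pow]; norm_num
          rw [div_pow, one_pow, pow_succ, h4]
          field_simp

theorem chordMean_nonneg (H : UCircle → ℂ) (t : UCircle) {δ : ℝ} (hδ : 0 ≤ δ) :
    0 ≤ chordMean H t δ :=
  mul_nonneg (inv_nonneg.2 hδ) (integral_nonneg fun _ => norm_nonneg _)

theorem exists_chordMean_le {H : UCircle → ℂ} (hH : Integrable H circleMeasure) {t : UCircle}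
    (hlim : Tendsto (chordMean H t) (𝓝[>] 0) (𝓝 0)) : ∃ B, ∀ δ > 0, chordMean H t δ ≤ B := by
  have h1 := hlim.eventually (ge_mem_nhds one_pos)
  obtain ⟨δ₀, hδ₀, hδ⟩ := mem_nhdsGT_iff_exists_Ioo_subset.1 h1
  refine ⟨max 1 (δ₀⁻¹ * ∫ s, ‖H s‖ ∂circleMeasure), fun δ hpos => ?_⟩
  rcases lt_or_ge δ δ₀ with h | h
  · exact (hδ ⟨hpos, h⟩).trans (le_max_left _ _)
  · refine le_trans ?_ (le_max_right _ _)
    have h0 : (0 : ℝ) < δ₀ := hδ₀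
    exact mul_le_mul (inv_anti₀ h0 h)
      (setIntegral_le_integral hH.norm (Eventually.of_forall fun _ => norm_nonneg _))
      (integral_nonneg fun _ => norm_nonneg _) (inv_nonneg.2 h0.le)

/-- The integral against the kernel with pole `(1 + ε) t` vanishes and may be subtracted.
Integrating the dyadic bound for the kernel difference term by term turns `4^(-k) / ε` into `2^(-k)`
times a mean at scale `2^k ε`. -/
theorem IsHOne.norm_truncatedCauchy_le {H : UCircle → ℂ} (hH : IsHOne H) {t : UCircle}
    {B : ℝ} (hB : ∀ δ > 0, chordMean H t δ ≤ B) {ε : ℝ} (hε : 0 < ε) :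
    ‖truncatedCauchy H t ε‖ ≤
      2 * ∑' k : ℕ, 4 * (1 / 2 : ℝ) ^ k * chordMean H t (2 ^ k * ε) := by
  set S := {s : UCircle | ε < ‖circlePt s - circlePt t‖} with hS
  have hSm : MeasurableSet S := measurableSet_lt_norm_circlePt_sub t ε
  set T : ℕ → Set UCircle := fun k => {s : UCircle | ‖circlePt s - circlePt t‖ ≤ 2 ^ k * ε} with hT
  have hTm : ∀ k, MeasurableSet (T k) := fun k => measurableSet_norm_circlePt_sub_le t _
  have hpos : ∀ k : ℕ, 0 ≤ 4 * (1 / 2 : ℝ) ^ k * chordMean H t (2 ^ k * ε) := fun k =>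
    mul_nonneg (by positivity) (chordMean_nonneg _ _ (by positivity))
  have hsummable : Summable fun k : ℕ => 4 * (1 / 2 : ℝ) ^ k * chordMean H t (2 ^ k * ε) := by
    refine .of_nonneg_of_le hpos (fun k => ?_)
      (((summable_geometric_of_lt_one (r := (1 / 2 : ℝ)) (by norm_num) (by norm_num)).mul_left
        4).mul_right B)
    exact mul_le_mul_of_nonneg_left (hB _ (by positivity)) (by positivity)
  have hint2 : Integrable (fun s => H s *
      (circlePt s / (circlePt s - (1 + ε : ℝ) * circlePt t))) circleMeasure := by
    refine hH.1.mul_bdd (c := ε⁻¹) (aestronglyMeasurable_cauchyKernel _ _)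
      (Eventually.of_forall fun s => ?_)
    rw [norm_div, norm_circlePt, one_div]
    refine inv_anti₀ hε ?_
    simpa using sub_one_le_norm_circlePt_sub s t (r := 1 + ε) (by linarith)
  have hint1 : Integrable (S.indicator fun s => H s *
      (circlePt s / (circlePt s - circlePt t))) circleMeasure := (integrableOn_mul_cauchyKernel hH.1 t hε).integrable_indicator hSm
  have heq : ∫ s in S, H s * (circlePt s / (circlePt s - circlePt t)) ∂circleMeasure =
      ∫ s, H s * (S.indicator (fun s => circlePt s / (circlePt s - circlePt t)) s -
        circlePt s / (circlePt s - (1 + ε : ℝ) * circlePt t)) ∂circleMeasure := by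
    rw [← integral_indicator hSm]
    have h0 := hH.integral_cauchy_exterior t (r := 1 + ε) (by linarith)
    rw [← sub_zero (∫ s, S.indicator _ s ∂circleMeasure), ← h0, ← integral_sub hint1 hint2]
    congr 1 with s
    rw [mul_sub]
    congr 1
    by_cases hs : s ∈ S
    · rw [Set.indicator_of_mem hs, Set.indicator_of_mem hs]
    · rw [Set.indicator_of_notMem hs, Set.indicator_of_notMem hs, mul_zero]
  rw [truncatedCauchy_eq, norm_mul, Complex.norm_two]
  gcongr
  rw [heq, ← ENNReal.ofReal_le_ofReal_iff (tsum_nonneg hpos), ofReal_norm,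
    ENNReal.ofReal_tsum_of_nonneg hpos hsummable]
  calc _ ≤ ∫⁻ s, ‖H s * (S.indicator (fun s => circlePt s / (circlePt s - circlePt t)) s -
        circlePt s / (circlePt s - (1 + ε : ℝ) * circlePt t))‖ₑ ∂circleMeasure :=
        enorm_integral_le_lintegral_enorm _
    _ ≤ ∫⁻ s, ∑' k, (T k).indicator
          (fun s => ENNReal.ofReal (4 / ε * (1 / 4) ^ k) * ‖H s‖ₑ) s ∂circleMeasure := by
        refine lintegral_mono fun s => ?_
        rw [enorm_mul]
        refine (mul_le_mul_right (enorm_indicator_cauchyKernel_sub_le t s hε) _).trans ?_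
        rw [← ENNReal.tsum_mul_left]
        refine ENNReal.tsum_le_tsum fun k => ?_
        by_cases hs : s ∈ T k
        · rw [Set.indicator_of_mem hs, Set.indicator_of_mem hs, mul_comm]
        · rw [Set.indicator_of_notMem hs, mul_zero]
          exact zero_le
    _ = ∑' k, ∫⁻ s, (T k).indicator
          (fun s => ENNReal.ofReal (4 / ε * (1 / 4) ^ k) * ‖H s‖ₑ) s ∂circleMeasure :=
        lintegral_tsum fun k => (hH.1.1.enorm.const_mul _).indicator (hTm k)
    _ = _ := by
        congr 1 with k
        rw [lintegral_indicator (hTm k), lintegral_const_mul' _ _ ENNReal.ofReal_ne_top,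
          ← ofReal_integral_norm_eq_lintegral_enorm hH.1.integrableOn,
          ← ENNReal.ofReal_mul (by positivity), chordMean, ← mul_assoc]
        congr 2
        rw [show (1 / 4 : ℝ) = (1 / 2) * (1 / 2) by norm_num, mul_pow, div_pow, one_pow]
        field_simp

/-- Each mean in the dyadic series tends to zero, and all are bounded by `B`, so the geometric
weights permit dominated convergence of the series. -/
theorem IsHOne.hasCauchySingularIntegral_zero {H : UCircle → ℂ} (hH : IsHOne H) {t : UCircle}
    (hlim : Tendsto (chordMean H t) (𝓝[>] 0) (𝓝 0)) : HasCauchySingularIntegral H t 0 := by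
  obtain ⟨B, hB⟩ := exists_chordMean_le hH.1 hlim
  have hT : Tendsto (fun ε => 2 * ∑' k : ℕ, 4 * (1 / 2 : ℝ) ^ k * chordMean H t (2 ^ k * ε))
      (𝓝[>] 0) (𝓝 (2 * ∑' _k : ℕ, (0 : ℝ))) := by
    refine (tendsto_tsum_of_dominated_convergence
      (bound := fun k : ℕ => 4 * (1 / 2 : ℝ) ^ k * B)
      (((summable_geometric_of_lt_one (r := (1 / 2 : ℝ)) (by norm_num) (by norm_num)).mul_left
        4).mul_right B) (fun k => ?_) ?_).const_mul 2
    · have h1 : Tendsto (fun ε : ℝ => 2 ^ k * ε) (𝓝[>] 0) (𝓝[>] 0) := by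
        refine tendsto_nhdsWithin_iff.2 ⟨?_, ?_⟩
        · have : Tendsto (fun ε : ℝ => 2 ^ k * ε) (𝓝 0) (𝓝 (2 ^ k * 0)) :=
            tendsto_id.const_mul _
          rw [mul_zero] at this
          exact this.mono_left nhdsWithin_le_nhds
        · filter_upwards [self_mem_nhdsWithin] with ε hε
          exact mul_pos (pow_pos two_pos k) (show (0 : ℝ) < ε from hε)
      simpa using (hlim.comp h1).const_mul (4 * (1 / 2 : ℝ) ^ k)
    · refine eventually_nhdsWithin_of_forall fun ε hε k => ?_
      replace hε : (0 : ℝ) < ε := hε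
      rw [Real.norm_of_nonneg (mul_nonneg (by positivity)
        (chordMean_nonneg _ _ (by positivity)))]
      exact mul_le_mul_of_nonneg_left (hB _ (by positivity)) (by positivity)
  rw [tsum_zero, mul_zero] at hT
  refine squeeze_zero_norm' ?_ hT
  filter_upwards [self_mem_nhdsWithin] with ε hε
  exact hH.norm_truncatedCauchy_le hB hε

/-! ### Chords, arcs and Lebesgue points -/

theorem circlePt_add (s t : UCircle) : circlePt (s + t) = circlePt s * circlePt t := by
  rw [circlePt, AddCircle.toCircle_add, Circle.coe_mul]
  rfl

theorem circlePt_sub (s t : UCircle) : circlePt (s - t) = circlePt s / circlePt t := by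
  rw [eq_div_iff (circlePt_ne_zero t), ← circlePt_add, sub_add_cancel]

/-- Jordan's inequality for `2 |sin (y / 2)|`, with the angle represented in `[-π, π]`. It places
chordal discs inside metric balls. -/
theorem two_div_pi_mul_norm_le_norm_circlePt_sub_one (x : UCircle) :
    2 / Real.pi * ‖x‖ ≤ ‖circlePt x - 1‖ := by
  have hpi := Real.pi_pos
  obtain ⟨y, hy, rfl⟩ : ∃ y : ℝ, |y| ≤ Real.pi ∧ (y : UCircle) = x := by
    obtain ⟨y, hy, hyx⟩ := AddCircle.eq_coe_Ico x
    rcases le_total y Real.pi with h | h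
    · exact ⟨y, by rwa [abs_of_nonneg hy.1], hyx⟩
    · refine ⟨y - 2 * Real.pi, abs_le.2 ⟨by linarith, by linarith [hy.2]⟩, ?_⟩
      rw [AddCircle.coe_sub, AddCircle.coe_period, sub_zero, hyx]
  have hnorm : ‖(y : UCircle)‖ = |y| := by
    refine (AddCircle.norm_coe_eq_abs_iff _ (by positivity)).2 ?_
    rw [abs_of_pos (by positivity : 0 < 2 * Real.pi)]
    linarith
  have hc : circlePt (y : UCircle) = Complex.exp (Complex.I * y) := by
    rw [circlePt, AddCircle.toCircle_apply_mk, Circle.coe_exp, div_self (by positivity), one_mul,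
      mul_comm]
  rw [hnorm, hc, Complex.norm_exp_I_mul_ofReal_sub_one, norm_mul, Real.norm_eq_abs,
    Real.norm_eq_abs, abs_two]
  have := Real.mul_abs_le_abs_sin (x := y / 2) (by rw [abs_div, abs_two]; linarith)
  rw [abs_div, abs_two] at this
  linarith

theorem norm_circlePt_sub_one_div (s t : UCircle) :
    ‖circlePt (s - t) - 1‖ = ‖circlePt s - circlePt t‖ := by
  have : circlePt (s - t) - 1 = (circlePt s - circlePt t) / circlePt t := by
    rw [circlePt_sub, sub_div, div_self (circlePt_ne_zero t)]
  rw [this, norm_div, norm_circlePt, div_one]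

theorem dist_le_of_norm_circlePt_sub_le {s t : UCircle} {δ : ℝ}
    (h : ‖circlePt s - circlePt t‖ ≤ δ) : dist s t ≤ Real.pi / 2 * δ := by
  have h1 := two_div_pi_mul_norm_le_norm_circlePt_sub_one (s - t)
  rw [norm_circlePt_sub_one_div] at h1
  have hpi := Real.pi_pos
  rw [dist_eq_norm]
  calc ‖s - t‖ = Real.pi / 2 * (2 / Real.pi * ‖s - t‖) := by field_simp
    _ ≤ Real.pi / 2 * δ := by gcongr; exact h1.trans h

theorem ae_volume_of_ae_circleMeasure {p : UCircle → Prop} :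
    (∀ᵐ t ∂(volume : Measure UCircle), p t) ↔ ∀ᵐ t ∂circleMeasure, p t := by
  rw [AddCircle.volume_eq_smul_haarAddCircle, Measure.ae_ennreal_smul_measure_iff]
  simpa using Real.pi_pos

theorem integral_circleMeasure_restrict (S : Set UCircle) (f : UCircle → ℝ) :
    ∫ s in S, f s ∂circleMeasure = (2 * Real.pi)⁻¹ * ∫ s in S, f s := by
  have hpi := Real.pi_pos
  rw [AddCircle.volume_eq_smul_haarAddCircle, Measure.restrict_smul, integral_smul_measure,
    ENNReal.toReal_ofReal (by positivity), smul_eq_mul, inv_mul_cancel_left₀ (by positivity)]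

/-- Lebesgue differentiation: the chordal disc of radius `δ` lies in the arc ball of radius `π δ /
2`, whose length is at most `π δ`, so the chordal mean is dominated by the average over that ball.
-/
theorem ae_tendsto_chordMean {f : UCircle → ℂ} (hf : Integrable f circleMeasure) :
    ∀ᵐ t ∂circleMeasure, Tendsto (chordMean (fun s => f s - f t) t) (𝓝[>] 0) (𝓝 0) := by
  have hpi := Real.pi_pos
  have hfv : Integrable f volume := by
    rw [AddCircle.volume_eq_smul_haarAddCircle]
    exact hf.smul_measure ENNReal.ofReal_ne_top
  have hleb := IsUnifLocDoublingMeasure.ae_tendsto_average_norm_sub volume hfv.locallyIntegrable 1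
  filter_upwards [ae_volume_of_ae_circleMeasure.1 hleb] with t ht
  have hδ : Tendsto (fun δ : ℝ => Real.pi / 2 * δ) (𝓝[>] 0) (𝓝[>] 0) := by
    refine tendsto_nhdsWithin_iff.2 ⟨?_, ?_⟩
    · have : Tendsto (fun δ : ℝ => Real.pi / 2 * δ) (𝓝 0) (𝓝 (Real.pi / 2 * 0)) :=
        tendsto_id.const_mul _
      rw [mul_zero] at this
      exact this.mono_left nhdsWithin_le_nhds
    · exact eventually_nhdsWithin_of_forall fun δ hδ => 
        mul_pos (half_pos hpi) (show (0 : ℝ) < δ from hδ)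
  have h1 := ht (fun _ => t) _ hδ (eventually_nhdsWithin_of_forall fun δ hδ => by
    have : (0 : ℝ) < δ := hδ
    exact Metric.mem_closedBall_self (by positivity))
  refine squeeze_zero' (eventually_nhdsWithin_of_forall fun δ hδ =>
    chordMean_nonneg _ _ (le_of_lt hδ)) (eventually_nhdsWithin_of_forall fun δ hδ => ?_) h1
  replace hδ : (0 : ℝ) < δ := hδ
  have hsub : {s : UCircle | ‖circlePt s - circlePt t‖ ≤ δ} ⊆
      Metric.closedBall t (Real.pi / 2 * δ) := fun s hs => dist_le_of_norm_circlePt_sub_le hs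
  have hInt : Integrable (fun s => ‖f s - f t‖) volume := (hfv.sub (integrable_const _)).norm
  have hvol : volume.real (Metric.closedBall t (Real.pi / 2 * δ)) ≤ Real.pi * δ := by
    rw [measureReal_def, AddCircle.volume_closedBall, ENNReal.toReal_ofReal (by positivity)]
    refine (min_le_right _ _).trans (le_of_eq ?_)
    ring
  have hvol0 : 0 < volume.real (Metric.closedBall t (Real.pi / 2 * δ)) := by
    rw [measureReal_def, AddCircle.volume_closedBall, ENNReal.toReal_ofReal (by positivity)]
    positivity
  have hJ : 0 ≤ ∫ s in Metric.closedBall t (Real.pi / 2 * δ), ‖f s - f t‖ :=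
    integral_nonneg fun _ => norm_nonneg _
  rw [chordMean, integral_circleMeasure_restrict, setAverage_eq, smul_eq_mul, ← mul_assoc,
    ← mul_inv]
  refine mul_le_mul (inv_anti₀ hvol0 (hvol.trans ?_))
    (setIntegral_mono_set hInt.integrableOn (Eventually.of_forall fun _ => norm_nonneg _)
      hsub.eventuallyLE) (integral_nonneg fun _ => norm_nonneg _) (inv_nonneg.2 hvol0.le)
  nlinarith [mul_pos hpi hδ]

/-! ### Principal values of analytic and antianalytic functions -/

theorem circleMeasure_singleton (x : UCircle) : circleMeasure {x} = 0 := by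
  have hpi := Real.pi_pos
  have h := AddCircle.volume_closedBall (T := 2 * Real.pi) (x := x) 0
  rw [Metric.closedBall_zero, AddCircle.volume_eq_smul_haarAddCircle, Measure.smul_apply,
    smul_eq_mul, mul_zero, min_eq_right (by positivity), ENNReal.ofReal_zero, mul_eq_zero] at h
  refine h.resolve_left ?_
  simpa using hpi

theorem ae_circlePt_ne (t : UCircle) : ∀ᵐ s ∂circleMeasure, 0 < ‖circlePt s - circlePt t‖ := by
  have : ∀ᵐ s ∂circleMeasure, s ≠ t := by
    rw [ae_iff]
    exact measure_mono_null (fun s hs => not_not.1 hs) (circleMeasure_singleton t)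
  filter_upwards [this] with s hs
  rw [norm_pos_iff, sub_ne_zero]
  exact fun h => hs (AddCircle.injective_toCircle (by positivity) (Subtype.ext h))

theorem tendsto_integral_far {f : UCircle → ℂ} (hf : Integrable f circleMeasure) (t : UCircle) :
    Tendsto (fun ε => ∫ s in {s : UCircle | ε < ‖circlePt s - circlePt t‖}, f s ∂circleMeasure)
      (𝓝[>] 0) (𝓝 (∫ s, f s ∂circleMeasure)) := by
  simp only [← integral_indicator (measurableSet_lt_norm_circlePt_sub t _)]
  refine tendsto_integral_filter_of_dominated_convergence (fun s => ‖f s‖)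
    (Eventually.of_forall fun ε => hf.1.indicator (measurableSet_lt_norm_circlePt_sub t ε))
    (Eventually.of_forall fun ε => Eventually.of_forall fun s => norm_indicator_le_norm_self _ _)
    hf.norm ?_
  filter_upwards [ae_circlePt_ne t] with s hs
  refine tendsto_const_nhds.congr' ?_
  filter_upwards [nhdsWithin_le_nhds (Iio_mem_nhds hs)] with ε hε
  exact (Set.indicator_of_mem (by exact hε) _).symm

/-- The reflection `s ↦ t² / s` of the circle preserves the truncation and the measure, and turns
the kernel `K` into `1 - K`. -/
theorem integral_far_cauchyKernel (t : UCircle) {ε : ℝ} (hε : 0 < ε) :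
    2 * ∫ s in {s : UCircle | ε < ‖circlePt s - circlePt t‖},
      circlePt s / (circlePt s - circlePt t) ∂circleMeasure =
    ∫ _s in {s : UCircle | ε < ‖circlePt s - circlePt t‖}, (1 : ℂ) ∂circleMeasure := by
  set S := {s : UCircle | ε < ‖circlePt s - circlePt t‖}
  have hSm : MeasurableSet S := measurableSet_lt_norm_circlePt_sub t ε
  have hk : IntegrableOn (fun s => circlePt s / (circlePt s - circlePt t)) S circleMeasure := by
    simpa using integrableOn_mul_cauchyKernel (integrable_const (1 : ℂ)) t hε
  have ht0 := circlePt_ne_zero t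
  have hrefl : ∫ s in S, circlePt s / (circlePt s - circlePt t) ∂circleMeasure =
      ∫ s in S, (1 - circlePt s / (circlePt s - circlePt t)) ∂circleMeasure := by
    rw [← integral_indicator hSm, ← integral_indicator hSm,
      ← integral_sub_left_eq_self _ circleMeasure (t + t)]
    congr 1 with s
    have hs0 := circlePt_ne_zero s
    have h1 : circlePt (t + t - s) - circlePt t =
        -(circlePt t / circlePt s * (circlePt s - circlePt t)) := by
      rw [circlePt_sub, circlePt_add]
      field_simp
      ring
    have hmem : t + t - s ∈ S ↔ s ∈ S := by
      change ε < ‖circlePt (t + t - s) - circlePt t‖ ↔ ε < ‖circlePt s - circlePt t‖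
      rw [h1, norm_neg, norm_mul, norm_div,
        norm_circlePt, norm_circlePt, div_one, one_mul]
    by_cases hs : s ∈ S
    · rw [Set.indicator_of_mem hs, Set.indicator_of_mem (hmem.2 hs), h1]
      have h2 : circlePt s - circlePt t ≠ 0 := norm_pos_iff.1 (hε.trans hs)
      rw [circlePt_sub, circlePt_add]
      field_simp
      ring
    · rw [Set.indicator_of_notMem hs, Set.indicator_of_notMem (fun h => hs (hmem.1 h))]
  rw [integral_sub (integrable_const _) hk] at hrefl
  linear_combination hrefl

/-- The Cauchy singular integral of an `H¹` function is the function itself. -/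
theorem IsHOne.ae_hasCauchySingularIntegral {f : UCircle → ℂ} (hf : IsHOne f) :
    ∀ᵐ t ∂circleMeasure, HasCauchySingularIntegral f t (f t) := by
  filter_upwards [ae_tendsto_chordMean hf.1] with t ht
  -- Split `f` into `f - f(t)`, whose singular integral at the Lebesgue point `t` is zero, and the
  -- constant `f(t)`, for which reflection gives the value.
  have h1 := (hf.sub (.const (f t))).hasCauchySingularIntegral_zero ht
  have h2 : HasCauchySingularIntegral (fun _ => 1) t 1 := by
    have h := tendsto_integral_far (integrable_const (1 : ℂ)) t
    rw [integral_const, probReal_univ, one_smul] at h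
    refine h.congr' (eventually_nhdsWithin_of_forall fun ε hε => ?_)
    rw [truncatedCauchy_eq, ← integral_far_cauchyKernel t hε]
    simp only [one_mul]
  have h3 := h1.add (hf.1.sub (integrable_const _)) ((integrable_const 1).const_mul (f t))
    (h2.const_mul (f t))
  simpa using h3

/-- The Cauchy singular integral of an antianalytic function with mean zero. -/
theorem IsHOne.ae_hasCauchySingularIntegral_conj {f : UCircle → ℂ} (hf : IsHOne f)
    (h0 : ∫ t, f t ∂circleMeasure = 0) :
    ∀ᵐ t ∂circleMeasure, HasCauchySingularIntegral (fun s => starRingEnd ℂ (f s)) t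
      (-starRingEnd ℂ (f t)) := by
  filter_upwards [hf.ae_hasCauchySingularIntegral] with t ht
  -- On the circle the conjugate of `K = s / (s - t)` is `1 - K`. So the truncated integral of `conj
  -- f` is the conjugate of `2 ∫ f` over the far set minus that of `f`, and the first term tends to
  -- zero.
  have h1 := ((tendsto_integral_far hf.1 t).const_mul 2).sub ht
  rw [h0, mul_zero, zero_sub] at h1
  have h2 := (Complex.continuous_conj.tendsto _).comp h1
  rw [map_neg] at h2
  refine h2.congr' (eventually_nhdsWithin_of_forall fun ε hε => ?_)
  replace hε : 0 < ε := hε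
  rw [Function.comp_apply, truncatedCauchy_eq, truncatedCauchy_eq, ← mul_sub,
    ← integral_sub hf.1.integrableOn (integrableOn_mul_cauchyKernel hf.1 t hε), map_mul,
    ← integral_conj]
  rw [map_ofNat]
  congr 1
  refine setIntegral_congr_fun (measurableSet_lt_norm_circlePt_sub t ε) fun s hs => ?_
  have hs0 : circlePt s - circlePt t ≠ 0 := norm_pos_iff.1 (hε.trans hs)
  have hc : ∀ r : UCircle, starRingEnd ℂ (circlePt r) = (circlePt r)⁻¹ := fun r => by
    rw [circlePt, ← Circle.coe_inv_eq_conj, Circle.coe_inv]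
  have e1 := circlePt_ne_zero s
  have e2 := circlePt_ne_zero t
  have e3 : (circlePt s)⁻¹ - (circlePt t)⁻¹ = -(circlePt s - circlePt t) /
      (circlePt s * circlePt t) := by
    field_simp
    ring
  simp only [map_sub, map_mul, map_div₀, hc]
  rw [e3]
  field_simp
  ring

theorem ae_hasCauchySingularIntegral_fourier_of_neg {k : ℤ} (hk : k < 0) :
    ∀ᵐ t : UCircle ∂circleMeasure,
      HasCauchySingularIntegral (fun s => fourier k s) t (-fourier k t) := by
  have h := IsHOne.ae_hasCauchySingularIntegral_conj
    ((IsHOne.const 1).mul_fourier (k := -k) (by omega)) (by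
      rw [← fourierCoeff_zero_eq_integral, fourierCoeff_mul_fourier, fourierCoeff_const,
        if_neg (by omega)])
  filter_upwards [h] with t ht
  simpa only [one_mul, ← fourier_neg, neg_neg] using ht

/-! ### The Riesz projection of `e₋ₙ g` for `g` in `H¹` -/

theorem IsRieszProjection.ae_eq {f g g' : UCircle → ℂ} (hg : IsRieszProjection f g)
    (hg' : IsRieszProjection f g') : g =ᵐ[circleMeasure] g' := by
  filter_upwards [hg.2, hg'.2] with t h1 h2
  obtain ⟨z, hz, hgz⟩ := h1
  obtain ⟨z', hz', hgz'⟩ := h2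
  rw [hgz, hgz', tendsto_nhds_unique hz hz']

/-- The function `e₋ₙ (g - ∑_{k < n} ĝ(k) eₖ)`. -/
noncomputable def backwardShift (n : ℕ) (g : UCircle → ℂ) (t : UCircle) : ℂ :=
  (g t - ∑ k ∈ Finset.range n, fourierCoeff g k * fourier k t) * fourier (-n : ℤ) t

theorem integrable_sum_mul_fourier (n : ℕ) (c : ℕ → ℂ) :
    Integrable (fun t : UCircle => ∑ k ∈ Finset.range n, c k * fourier k t) circleMeasure :=
  integrable_finsetSum _ fun k _ => by
    simpa using ((integrable_const (1 : ℂ)).mul_fourier k).const_mul (c k)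

theorem IsHOne.backwardShift {g : UCircle → ℂ} (hg : IsHOne g) (n : ℕ) :
    IsHOne (backwardShift n g) := by
  have hi := integrable_sum_mul_fourier n fun k => fourierCoeff g k
  refine ⟨(hg.1.sub hi).mul_fourier _, fun m hm => ?_⟩
  unfold _root_.backwardShift
  rw [fourierCoeff_mul_fourier, fourierCoeff_sub_apply hg.1 hi, fourierCoeff_sum_apply _ _
    fun k _ => by simpa using ((integrable_const (1 : ℂ)).mul_fourier k).const_mul (fourierCoeff g k)]
  simp only [fourierCoeff.const_mul, fourierCoeff_fourier_apply]
  rw [sub_neg_eq_add]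
  rcases lt_or_ge (m + n) 0 with h | h
  · rw [hg.2 _ h, zero_sub, neg_eq_zero]
    refine Finset.sum_eq_zero fun k _ => ?_
    rw [if_neg (by omega), mul_zero]
  · obtain ⟨j, hj⟩ := Int.eq_ofNat_of_zero_le h
    rw [hj, Finset.sum_eq_single j]
    · simp
    · intro k _ hk
      rw [if_neg (by omega), mul_zero]
    · intro hjn
      exact absurd (Finset.mem_range.2 (by omega)) hjn

/-- Split `e₋ₙ g` into the shifted remainder, which is in `H¹`, and finitely many exponentials of
frequency `k - n < 0`. Then `S` acts as the identity on the former and as minus the identity on the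
latter, so `(I + S)/2` keeps only the former. -/
theorem IsHOne.isRieszProjection_backwardShift {g : UCircle → ℂ} (hg : IsHOne g) (n : ℕ) :
    IsRieszProjection (fun t => g t * fourier (-n : ℤ) t) (_root_.backwardShift n g) := by
  refine ⟨hg.1.mul_fourier _, ?_⟩
  have hneg : ∀ᵐ t : UCircle ∂circleMeasure, ∀ k ∈ Finset.range n,
      HasCauchySingularIntegral (fun s => fourier (k - n : ℤ) s) t (-fourier (k - n : ℤ) t) := by
    rw [Finset.eventually_all]
    intro k hk
    exact ae_hasCauchySingularIntegral_fourier_of_neg (by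
      have := Finset.mem_range.1 hk
      omega)
  have hdecomp : ∀ t, g t * fourier (-n : ℤ) t = _root_.backwardShift n g t +
      ∑ k ∈ Finset.range n, fourierCoeff g k * fourier (k - n : ℤ) t := by
    intro t
    simp only [_root_.backwardShift, sub_eq_add_neg (_ : ℤ) (n : ℤ), fourier_add, ← mul_assoc]
    rw [← Finset.sum_mul]
    ring
  filter_upwards [(hg.backwardShift n).ae_hasCauchySingularIntegral, hneg] with t h1 h2
  have hi : ∀ k ∈ Finset.range n, Integrable
      (fun s : UCircle => fourierCoeff g k * fourier (k - n : ℤ) s) circleMeasure := fun k _ => by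
    simpa using ((integrable_const (1 : ℂ)).mul_fourier (k - n)).const_mul (fourierCoeff g k)
  have h3 := h1.add (hg.backwardShift n).1 (integrable_finsetSum _ hi)
    (HasCauchySingularIntegral.sum _ hi fun k hk => (h2 k hk).const_mul (fourierCoeff g k))
  refine ⟨_, h3.congr_ae (Eventually.of_forall fun s => (hdecomp s).symm), ?_⟩
  rw [hdecomp t]
  simp only [mul_neg, Finset.sum_neg_distrib]
  ring

/-! ### Hölder's inequality and the embedding of `H[X(w)]` in `L¹` -/

namespace BanachFunctionNorm

variable (ρ : BanachFunctionNorm)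

theorem congr_ae {f g : UCircle → ℝ≥0∞} (hf : AEMeasurable f circleMeasure)
    (h : f =ᵐ[circleMeasure] g) : ρ.toFun f = ρ.toFun g :=
  le_antisymm (ρ.mono _ _ (hf.congr h) hf h.le) (ρ.mono _ _ hf (hf.congr h) h.symm.le)

theorem lintegral_mul_le {f g : UCircle → ℝ≥0∞} (hf : AEMeasurable f circleMeasure)
    (hfin : ρ.toFun f < ∞) : ∫⁻ t, f t * g t ∂circleMeasure ≤ ρ.toFun f * ρ.associate g := by
  by_cases h0 : ρ.toFun f = 0
  · have : ∫⁻ t, f t * g t ∂circleMeasure = ∫⁻ _, 0 ∂circleMeasure := by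
      refine lintegral_congr_ae ?_
      filter_upwards [(ρ.eq_zero_iff f hf).1 h0] with t ht
      rw [ht, Pi.zero_apply, zero_mul]
    rw [this, lintegral_zero]
    exact zero_le
  · have hc0 : (ρ.toFun f).toNNReal ≠ 0 := (ENNReal.toNNReal_pos h0 hfin.ne).ne'
    set a : ℝ≥0 := ((ρ.toFun f).toNNReal)⁻¹ with ha
    have haρ : (a : ℝ≥0∞) = (ρ.toFun f)⁻¹ := by
      rw [ha, ENNReal.coe_inv hc0, ENNReal.coe_toNNReal hfin.ne]
    have h1 : ρ.toFun (fun t => (a : ℝ≥0∞) * f t) ≤ 1 := by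
      rw [ρ.smul a f hf, haρ, ENNReal.inv_mul_cancel h0 hfin.ne]
    have h2 : ∫⁻ t, (a : ℝ≥0∞) * f t * g t ∂circleMeasure ≤ ρ.associate g :=
      le_iSup_of_le (fun t => (a : ℝ≥0∞) * f t)
        (le_iSup_of_le (hf.const_mul _) (le_iSup_of_le h1 le_rfl))
    simp only [mul_assoc] at h2
    rw [lintegral_const_mul' _ _ ENNReal.coe_ne_top, haρ] at h2
    calc ∫⁻ t, f t * g t ∂circleMeasure
        = ρ.toFun f * ((ρ.toFun f)⁻¹ * ∫⁻ t, f t * g t ∂circleMeasure) := by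
          rw [← mul_assoc, ENNReal.mul_inv_cancel h0 hfin.ne, one_mul]
      _ ≤ _ := by gcongr

end BanachFunctionNorm

namespace HardySpace

variable {ρ : BanachFunctionNorm} {w : CircleWeight}

theorem ext_ae {f g : HardySpace ρ w} (h : f.toAEEqFun =ᵐ[circleMeasure] g.toAEEqFun) : f = g :=
  Subtype.ext (AEEqFun.ext h)

theorem isHOne (f : HardySpace ρ w) : IsHOne f.toAEEqFun :=
  (Subtype.property (p := fun g => g ∈ hardySubmodule ρ w) f).2

/-- The element of `H[X(w)]` given by an `H¹` function of finite norm. -/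
noncomputable def ofFun (F : UCircle → ℂ) (hF : IsHOne F)
    (hfin : ρ.toFun (fun t => ‖F t‖ₑ * w.toFun t) < ∞) : HardySpace ρ w :=
  Subtype.mk (p := fun g => g ∈ hardySubmodule ρ w) (AEEqFun.mk F hF.1.1) (by
    have h := AEEqFun.coeFn_mk F hF.1.1
    refine ⟨?_, hF.congr_ae h.symm⟩
    change ρ.toFun (fun t => ‖AEEqFun.mk F hF.1.1 t‖ₑ * w.toFun t) < ∞
    rwa [ρ.congr_ae (aemeasurable_enorm_mul_weight w _)
      (h.mono fun t ht => show _ = ‖F t‖ₑ * w.toFun t by simp only [ht])])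

theorem coeFn_ofFun (F : UCircle → ℂ) (hF : IsHOne F)
    (hfin : ρ.toFun (fun t => ‖F t‖ₑ * w.toFun t) < ∞) :
    (ofFun F hF hfin).toAEEqFun =ᵐ[circleMeasure] F :=
  AEEqFun.coeFn_mk F hF.1.1

theorem norm_eq_of_ae_eq {f : HardySpace ρ w} {F : UCircle → ℂ}
    (h : f.toAEEqFun =ᵐ[circleMeasure] F) :
    ‖f‖ = (ρ.toFun (fun t => ‖F t‖ₑ * w.toFun t)).toReal := by
  rw [norm_def, weightedENorm, ρ.congr_ae (aemeasurable_enorm_mul_weight w _)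
      (h.mono fun t ht => show _ = ‖F t‖ₑ * w.toFun t by simp only [ht])]

theorem coeFn_add (f g : HardySpace ρ w) :
    (f + g).toAEEqFun =ᵐ[circleMeasure] fun t => f.toAEEqFun t + g.toAEEqFun t :=
  AEEqFun.coeFn_add f.toAEEqFun g.toAEEqFun

theorem coeFn_smul (c : ℂ) (f : HardySpace ρ w) :
    (c • f).toAEEqFun =ᵐ[circleMeasure] fun t => c * f.toAEEqFun t :=
  AEEqFun.coeFn_smul c f.toAEEqFun

/-- Hölder's inequality for `|f| w` and `1/w`. It is what bounds the Fourier coefficients in terms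
of the norm of `X(w)`. -/
theorem integral_norm_le (hw' : ρ.associate (fun t => (w.toFun t)⁻¹) < ∞) (f : HardySpace ρ w) :
    ∫ t, ‖f.toAEEqFun t‖ ∂circleMeasure ≤
      (ρ.associate fun t => (w.toFun t)⁻¹).toReal * ‖f‖ := by
  have hfin : ρ.toFun (fun t => ‖f.toAEEqFun t‖ₑ * w.toFun t) < ∞ :=
    f.weightedENorm_ne_top.lt_top
  have h := ρ.lintegral_mul_le (g := fun t => (w.toFun t)⁻¹)
    (aemeasurable_enorm_mul_weight w f.toAEEqFun) hfin
  have heq : ∫⁻ t, ‖f.toAEEqFun t‖ₑ * w.toFun t * (w.toFun t)⁻¹ ∂circleMeasure =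
      ∫⁻ t, ‖f.toAEEqFun t‖ₑ ∂circleMeasure := by
    refine lintegral_congr_ae ?_
    filter_upwards [w.pos, w.lt_top] with t h1 h2
    rw [mul_assoc, ENNReal.mul_inv_cancel h1.ne' h2.ne, mul_one]
  rw [heq, ← ofReal_integral_norm_eq_lintegral_enorm f.isHOne.1] at h
  rw [norm_def, weightedENorm, ← ENNReal.toReal_mul]
  refine (ENNReal.ofReal_le_iff_le_toReal (ENNReal.mul_ne_top hw'.ne hfin.ne)).1 (h.trans ?_)
  exact (mul_comm _ _).le

end HardySpace

theorem norm_fourierCoeff_le {f : UCircle → ℂ} (n : ℤ) :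
    ‖fourierCoeff f n‖ ≤ ∫ t, ‖f t‖ ∂circleMeasure := by
  refine (norm_integral_le_integral_norm _).trans (le_of_eq ?_)
  congr 1 with t
  rw [norm_smul, norm_fourier_apply, one_mul]

theorem fourierCoeff_mul_coeFn_add {ρ : BanachFunctionNorm} {w : CircleWeight} {g : UCircle → ℂ}
    (f₁ f₂ : HardySpace ρ w) (h₁ : Integrable (fun t => g t * f₁.toAEEqFun t) circleMeasure)
    (h₂ : Integrable (fun t => g t * f₂.toAEEqFun t) circleMeasure) (k : ℤ) :
    fourierCoeff (fun t => g t * (f₁ + f₂).toAEEqFun t) k =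
      fourierCoeff (fun t => g t * f₁.toAEEqFun t) k +
        fourierCoeff (fun t => g t * f₂.toAEEqFun t) k := by
  rw [← fourierCoeff_add_apply h₁ h₂]
  refine congr_fun (fourierCoeff_congr_ae ?_) k
  filter_upwards [HardySpace.coeFn_add f₁ f₂] with t ht
  rw [ht, mul_add]

theorem fourierCoeff_mul_coeFn_smul {ρ : BanachFunctionNorm} {w : CircleWeight} {g : UCircle → ℂ}
    (c : ℂ) (f : HardySpace ρ w) (k : ℤ) :
    fourierCoeff (fun t => g t * (c • f).toAEEqFun t) k =
      c * fourierCoeff (fun t => g t * f.toAEEqFun t) k := by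
  rw [← fourierCoeff.const_mul]
  refine congr_fun (fourierCoeff_congr_ae ?_) k
  filter_upwards [HardySpace.coeFn_smul c f] with t ht
  rw [ht]
  ring

/-! ### The Toeplitz operator: existence, boundedness, uniqueness -/

section Toeplitz

variable {ρ : BanachFunctionNorm} {w : CircleWeight} {n : ℕ} {h : UCircle → ℂ}

/-- Since `|e₋ₙ| = 1`, the shift is pointwise at most `C |f| + ∑ |ĝ(k)|`; multiplying by `w` leaves
a multiple of `|f| w` and a multiple of `w`. -/
theorem toFun_backwardShift_le {g : UCircle → ℂ} {C : ℝ≥0} (hC : ∀ᵐ t ∂circleMeasure, ‖h t‖ ≤ C)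
    (f : HardySpace ρ w) (hg : IsHOne g) (hgf : g =ᵐ[circleMeasure] fun t => h t * f.toAEEqFun t) :
    ρ.toFun (fun t => ‖backwardShift n g t‖ₑ * w.toFun t) ≤
      C * weightedENorm ρ w f.toAEEqFun +
        (∑ k ∈ Finset.range n, ‖fourierCoeff g k‖₊ : ℝ≥0) * ρ.toFun w.toFun := by
  have hfm := aemeasurable_enorm_mul_weight w f.toAEEqFun
  have hwm := w.measurable.aemeasurable (μ := circleMeasure)
  have hm := ((hg.backwardShift n).1.1.enorm).mul hwm
  rw [weightedENorm, ← ρ.smul C _ hfm, ← ρ.smul _ _ hwm]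
  refine (ρ.mono _ _ ((hfm.const_mul _).add (hwm.const_mul _)) hm ?_).trans
    (ρ.add_le _ _ (hfm.const_mul _) (hwm.const_mul _))
  filter_upwards [hC, hgf] with t h1 h2
  simp only [Pi.mul_apply, Pi.add_apply]
  rw [← mul_assoc, ← add_mul]
  gcongr
  rw [backwardShift, enorm_mul]
  have h3 : ‖fourier (-n : ℤ) t‖ₑ = 1 := by
    rw [← ofReal_norm, norm_fourier_apply, ENNReal.ofReal_one]
  rw [h3, mul_one, enorm_eq_nnnorm, enorm_eq_nnnorm]
  norm_cast
  refine (nnnorm_sub_le _ _).trans (add_le_add ?_ ((nnnorm_sum_le _ _).trans ?_))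
  · rw [h2, nnnorm_mul]
    gcongr
    exact h1
  · refine Finset.sum_le_sum fun k _ => ?_
    rw [nnnorm_mul]
    have h4 : ‖fourier (k : ℤ) t‖₊ = 1 := by
      ext
      simpa using norm_fourier_apply k t
    rw [h4, mul_one]

theorem symbol_mul_eq (t : UCircle) (z : ℂ) :
    circlePt t ^ (-(n : ℤ)) * h t * z = h t * z * fourier (-n : ℤ) t := by
  rw [fourier_eq_circlePt_zpow]
  ring

theorem exists_isToeplitz (hw : ρ.toFun w.toFun < ∞)
    (hw' : ρ.associate (fun t => (w.toFun t)⁻¹) < ∞) (n : ℕ) (hh : MemHInfty h) :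
    ∃ A : HardySpace ρ w →L[ℂ] HardySpace ρ w,
      IsToeplitz (fun t => circlePt t ^ (-(n : ℤ)) * h t) A := by
  obtain ⟨C, hC⟩ := hh.exists_bound
  have hg : ∀ f : HardySpace ρ w, IsHOne fun t => h t * f.toAEEqFun t :=
    fun f => hh.isHOne_mul f.isHOne
  have hle := fun f : HardySpace ρ w =>
    toFun_backwardShift_le (n := n) hC f (hg f) (EventuallyEq.refl _ _)
  have htop : ∀ f : HardySpace ρ w, C * weightedENorm ρ w f.toAEEqFun +
      (∑ k ∈ Finset.range n, ‖fourierCoeff (fun t => h t * f.toAEEqFun t) k‖₊ : ℝ≥0) *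
        ρ.toFun w.toFun ≠ ∞ := fun f =>
    ENNReal.add_ne_top.2 ⟨ENNReal.mul_ne_top ENNReal.coe_ne_top f.weightedENorm_ne_top,
      ENNReal.mul_ne_top ENNReal.coe_ne_top hw.ne⟩
  have hfin := fun f => (hle f).trans_lt (htop f).lt_top
  let T : HardySpace ρ w → HardySpace ρ w := fun f =>
    .ofFun _ ((hg f).backwardShift n) (hfin f)
  have hT : ∀ f, (T f).toAEEqFun =ᵐ[circleMeasure]
      backwardShift n fun t => h t * f.toAEEqFun t := fun f => HardySpace.coeFn_ofFun _ _ _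
  let L : HardySpace ρ w →ₗ[ℂ] HardySpace ρ w :=
    { toFun := T
      map_add' := fun f g => by
        apply HardySpace.ext_ae
        filter_upwards [hT (f + g), hT f, hT g, HardySpace.coeFn_add (T f) (T g),
          HardySpace.coeFn_add f g] with t h1 h2 h3 h4 h5
        rw [h1, h4, h2, h3]
        simp only [backwardShift, fourierCoeff_mul_coeFn_add f g (hg f).1 (hg g).1, h5, add_mul,
          Finset.sum_add_distrib]
        ring
      map_smul' := fun c f => by
        apply HardySpace.ext_ae
        filter_upwards [hT (c • f), hT f, HardySpace.coeFn_smul c (T f),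
          HardySpace.coeFn_smul c f] with t h1 h2 h3 h4
        rw [RingHom.id_apply, h1, h3, h2]
        simp only [backwardShift, fourierCoeff_mul_coeFn_smul, h4, mul_assoc]
        rw [← Finset.mul_sum]
        ring }
  set K := (ρ.associate fun t => (w.toFun t)⁻¹).toReal with hK
  have hcoef : ∀ (f : HardySpace ρ w) (k : ℕ),
      ‖fourierCoeff (fun t => h t * f.toAEEqFun t) k‖ ≤ C * (K * ‖f‖) := fun f k => by
    refine (norm_fourierCoeff_le _).trans (le_trans ?_
      (mul_le_mul_of_nonneg_left (f.integral_norm_le hw') C.2))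
    rw [← integral_const_mul]
    refine integral_mono_ae (hg f).1.norm (f.isHOne.1.norm.const_mul _) ?_
    filter_upwards [hC] with t ht
    rw [norm_mul]
    gcongr
  refine ⟨L.mkContinuous (C + n * (C * K) * (ρ.toFun w.toFun).toReal) fun f => ?_, fun f => ?_⟩
  · change ‖T f‖ ≤ _
    rw [HardySpace.norm_eq_of_ae_eq (hT f)]
    refine (ENNReal.toReal_mono (htop f) (hle f)).trans ?_
    rw [ENNReal.toReal_add (ENNReal.mul_ne_top ENNReal.coe_ne_top f.weightedENorm_ne_top)
      (ENNReal.mul_ne_top ENNReal.coe_ne_top hw.ne), ENNReal.toReal_mul, ENNReal.toReal_mul,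
      ENNReal.coe_toReal, ENNReal.coe_toReal, ← HardySpace.norm_def, add_mul,
      mul_right_comm _ (ρ.toFun w.toFun).toReal]
    gcongr
    push_cast
    refine (Finset.sum_le_card_nsmul _ _ (C * (K * ‖f‖)) fun k _ => hcoef f k).trans
      (le_of_eq ?_)
    rw [Finset.card_range, nsmul_eq_mul]
    ring
  · have h1 := (hg f).isRieszProjection_backwardShift n
    refine ⟨?_, ?_⟩
    · simpa only [symbol_mul_eq] using h1.1
    · filter_upwards [h1.2, hT f] with t ht hTt
      simp only [symbol_mul_eq]
      change ∃ z, _ ∧ (T f).toAEEqFun t = _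
      rwa [hTt]

theorem IsToeplitz.coeFn_ae_eq {A : HardySpace ρ w →L[ℂ] HardySpace ρ w}
    (hA : IsToeplitz (fun t => circlePt t ^ (-(n : ℤ)) * h t) A) (hh : MemHInfty h)
    (f : HardySpace ρ w) :
    (A f).toAEEqFun =ᵐ[circleMeasure] backwardShift n fun t => h t * f.toAEEqFun t := by
  have h1 := (hh.isHOne_mul f.isHOne).isRieszProjection_backwardShift n
  have h2 := hA f
  simp only [symbol_mul_eq] at h2
  exact h2.ae_eq h1

theorem IsToeplitz.unique {a : UCircle → ℂ} {A B : HardySpace ρ w →L[ℂ] HardySpace ρ w}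
    (hA : IsToeplitz a A) (hB : IsToeplitz a B) : A = B :=
  ContinuousLinearMap.ext fun f => HardySpace.ext_ae ((hA f).ae_eq (hB f))

end Toeplitz

/-! ### Finite rank perturbations and isometric conjugation -/

section EssentialNorm

variable {E F : Type*} [NormedAddCommGroup E] [NormedSpace ℂ E] [NormedAddCommGroup F]
  [NormedSpace ℂ F]

/-- The range of `D` is a quotient of `E ⧸ ker L`, hence finite-dimensional and proper, so the
continuous `D` is compact. Continuity of `L` plays no role. -/
theorem isCompactOperator_of_ker_le {V : Type*} [AddCommGroup V] [Module ℂ V]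
    [FiniteDimensional ℂ V] (D : E →L[ℂ] F) (L : E →ₗ[ℂ] V)
    (h : LinearMap.ker L ≤ LinearMap.ker (D : E →ₗ[ℂ] F)) : IsCompactOperator D := by
  have : FiniteDimensional ℂ (E ⧸ LinearMap.ker L) := L.quotKerEquivRange.symm.finiteDimensional
  have hr : LinearMap.range (D : E →ₗ[ℂ] F) =
      LinearMap.range ((LinearMap.ker L).liftQ (D : E →ₗ[ℂ] F) h) :=
    (Submodule.range_liftQ _ _ _).symm
  have : FiniteDimensional ℂ (LinearMap.range (D : E →ₗ[ℂ] F)) := by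
    rw [hr]
    infer_instance
  have : ProperSpace (LinearMap.range (D : E →ₗ[ℂ] F)) := FiniteDimensional.proper ℂ _
  let D' : E →L[ℂ] LinearMap.range (D : E →ₗ[ℂ] F) :=
    D.codRestrict _ fun x => LinearMap.mem_range_self _ x
  exact (isCompactOperator_of_locallyCompactSpace_dom D').clm_comp
    (LinearMap.range (D : E →ₗ[ℂ] F)).subtypeL

/-- Conjugation of an operator by an isometric isomorphism. -/
noncomputable def isometryConj (Φ : E ≃ₗᵢ[ℂ] F) (T : E →L[ℂ] E) : F →L[ℂ] F :=
  ((Φ : E →L[ℂ] F).comp T).comp (Φ.symm : F →L[ℂ] E)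

theorem isometryConj_apply (Φ : E ≃ₗᵢ[ℂ] F) (T : E →L[ℂ] E) (x : F) :
    isometryConj Φ T x = Φ (T (Φ.symm x)) := rfl

theorem norm_isometryConj_le (Φ : E ≃ₗᵢ[ℂ] F) (T : E →L[ℂ] E) : ‖isometryConj Φ T‖ ≤ ‖T‖ := by
  refine ContinuousLinearMap.opNorm_le_bound _ (norm_nonneg _) fun x => ?_
  rw [isometryConj_apply, Φ.norm_map]
  simpa using T.le_opNorm (Φ.symm x)

theorem isometryConj_symm (Φ : E ≃ₗᵢ[ℂ] F) (T : E →L[ℂ] E) :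
    isometryConj Φ.symm (isometryConj Φ T) = T := by
  ext x
  simp [isometryConj_apply]

theorem norm_isometryConj (Φ : E ≃ₗᵢ[ℂ] F) (T : E →L[ℂ] E) : ‖isometryConj Φ T‖ = ‖T‖ := by
  refine le_antisymm (norm_isometryConj_le Φ T) ?_
  conv_lhs => rw [← isometryConj_symm Φ T]
  exact norm_isometryConj_le Φ.symm _

theorem IsCompactOperator.isometryConj {T : E →L[ℂ] E} (hT : IsCompactOperator T)
    (Φ : E ≃ₗᵢ[ℂ] F) : IsCompactOperator (isometryConj Φ T) :=
  (hT.clm_comp (Φ : E →L[ℂ] F)).comp_clm (Φ.symm : F →L[ℂ] E)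

/-- Operators that are isometrically conjugate up to a compact operator have equal essential
norms. -/
theorem essentialNorm_eq_of_isCompactOperator (Φ : E ≃ₗᵢ[ℂ] F) (A : E →L[ℂ] E) (B : F →L[ℂ] F)
    (hD : IsCompactOperator (isometryConj Φ.symm B - A : E →L[ℂ] E)) :
    essentialNorm A = essentialNorm B := by
  unfold essentialNorm
  congr 1
  ext r
  constructor
  · rintro ⟨K, hK, rfl⟩
    -- Chosen so that subtracting it from `B` leaves exactly the conjugate of `A - K`, which has the
    -- same norm.
    refine ⟨isometryConj Φ (isometryConj Φ.symm B - A + K),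
      IsCompactOperator.isometryConj (hD.add hK) Φ, ?_⟩
    rw [← norm_isometryConj Φ]
    congr 1
    ext x
    simp [isometryConj_apply]
    abel
  · rintro ⟨K, hK, rfl⟩
    refine ⟨isometryConj Φ.symm K - (isometryConj Φ.symm B - A),
      (hK.isometryConj Φ.symm).sub hD, ?_⟩
    rw [← norm_isometryConj Φ.symm]
    congr 1
    ext x
    simp [isometryConj_apply]
    abel

end EssentialNorm

/-! ### Multiplication by an outer function as an isometry of `H[X(w)]` onto `H[X]` -/

section Isometry

variable {ρ : BanachFunctionNorm} {w : CircleWeight}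

/-- This is axiom (A5); together with (A4) it lets results for `X(w)` be used for the weight `1`. -/
theorem BanachFunctionNorm.associate_one_lt_top (ρ : BanachFunctionNorm) :
    ρ.associate (fun t => ((1 : CircleWeight).toFun t)⁻¹) < ∞ := by
  obtain ⟨C, -, hC⟩ := ρ.lintegral_le
  refine lt_of_le_of_lt (iSup_le fun f => iSup_le fun hf => iSup_le fun h1 => ?_)
    (ENNReal.coe_lt_top (r := C))
  have h2 : ∀ t, f t * ((1 : CircleWeight).toFun t)⁻¹ = f t := fun t => by
    change f t * (1 : ℝ≥0∞)⁻¹ = f t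
    rw [inv_one, mul_one]
  simp only [h2]
  calc ∫⁻ t, f t ∂circleMeasure ≤ C * ρ.toFun f := hC f hf
    _ ≤ C * 1 := by gcongr
    _ = C := mul_one _

/-- Integrability of `w` comes from `X ⊆ L¹`; that of `1/w` comes from testing `1/w ∈ X'` against `1
∈ X`. -/
theorem CircleWeight.exists_isOuter (hw : ρ.toFun w.toFun < ∞)
    (hw' : ρ.associate (fun t => (w.toFun t)⁻¹) < ∞) :
    ∃ W, IsOuter (fun t => (w.toFun t).toReal) W := by
  obtain ⟨C, -, hC⟩ := ρ.lintegral_le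
  refine _root_.exists_isOuter ?_ (integrable_toReal_of_lintegral_ne_top
    w.measurable.aemeasurable ?_) ?_
  · filter_upwards [w.pos, w.lt_top] with t h1 h2 using ENNReal.toReal_pos h1.ne' h2.ne
  · exact ((hC _ w.measurable.aemeasurable).trans_lt
      (ENNReal.mul_lt_top ENNReal.coe_lt_top hw)).ne
  · simp only [← ENNReal.toReal_inv]
    refine integrable_toReal_of_lintegral_ne_top w.measurable.inv.aemeasurable ?_
    have h := ρ.lintegral_mul_le (f := fun _ => 1) (g := fun t => (w.toFun t)⁻¹)
      aemeasurable_const ρ.one_lt_top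
    simp only [one_mul] at h
    exact (h.trans_lt (ENNReal.mul_lt_top ρ.one_lt_top hw')).ne

variable {W : UCircle → ℂ}

theorem IsOuter.ae_enorm_eq (hW : IsOuter (fun t => (w.toFun t).toReal) W) :
    ∀ᵐ t ∂circleMeasure, ‖W t‖ₑ = w.toFun t := by
  filter_upwards [hW.norm_eq, w.lt_top] with t h1 h2
  rw [← ofReal_norm, h1, ENNReal.ofReal_toReal h2.ne]

theorem IsOuter.toFun_mul (hW : IsOuter (fun t => (w.toFun t).toReal) W) (f : HardySpace ρ w) :
    ρ.toFun (fun t => ‖f.toAEEqFun t * W t‖ₑ * (1 : CircleWeight).toFun t) =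
      weightedENorm ρ w f.toAEEqFun := by
  refine (ρ.congr_ae (aemeasurable_enorm_mul_weight w f.toAEEqFun) ?_).symm
  filter_upwards [hW.ae_enorm_eq] with t ht
  rw [enorm_mul, ht]
  exact (mul_one _).symm

theorem IsOuter.toFun_mul_inv (hW : IsOuter (fun t => (w.toFun t).toReal) W)
    (g : HardySpace ρ 1) :
    ρ.toFun (fun t => ‖g.toAEEqFun t * (W t)⁻¹‖ₑ * w.toFun t) =
      weightedENorm ρ 1 g.toAEEqFun := by
  refine (ρ.congr_ae (aemeasurable_enorm_mul_weight 1 g.toAEEqFun) ?_).symm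
  filter_upwards [hW.ae_enorm_eq, hW.ne_zero] with t ht h0
  rw [← ht, ← enorm_mul, inv_mul_cancel_right₀ h0]
  exact mul_one _

theorem IsOuter.isHOne_coeFn_mul (hW : IsOuter (fun t => (w.toFun t).toReal) W)
    (f : HardySpace ρ w) : IsHOne fun t => f.toAEEqFun t * W t := by
  refine hW.isHOne_mul _ f.isHOne ⟨f.isHOne.1.1.mul hW.1, ?_⟩
  obtain ⟨C, -, hC⟩ := ρ.lintegral_le
  have h1 := hC _ (f.isHOne.1.1.mul hW.1).enorm
  have h2 := hW.toFun_mul f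
  have h3 : ∀ t, ‖f.toAEEqFun t * W t‖ₑ * (1 : CircleWeight).toFun t = ‖f.toAEEqFun t * W t‖ₑ :=
    fun t => mul_one _
  simp only [h3] at h2
  simp only [Pi.mul_apply, h2] at h1
  exact h1.trans_lt (ENNReal.mul_lt_top ENNReal.coe_lt_top f.weightedENorm_ne_top.lt_top)

/-- Only integrability of `g / W` has to be checked, and this is Hölder's inequality for `g ∈ X` and
`1/w ∈ X'`. -/
theorem IsOuter.isHOne_coeFn_mul_inv (hW : IsOuter (fun t => (w.toFun t).toReal) W)
    (hw' : ρ.associate (fun t => (w.toFun t)⁻¹) < ∞)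
    (g : HardySpace ρ 1) : IsHOne fun t => g.toAEEqFun t * (W t)⁻¹ := by
  refine hW.isHOne_mul_inv _ g.isHOne ⟨g.isHOne.1.1.mul hW.1.inv₀, ?_⟩
  have hfin : ρ.toFun (fun t => ‖g.toAEEqFun t‖ₑ * (1 : CircleWeight).toFun t) < ∞ :=
    g.weightedENorm_ne_top.lt_top
  have h1 := ρ.lintegral_mul_le (g := fun t => (w.toFun t)⁻¹)
    (aemeasurable_enorm_mul_weight 1 g.toAEEqFun) hfin
  refine lt_of_le_of_lt (le_of_eq (lintegral_congr_ae ?_))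
    (h1.trans_lt (ENNReal.mul_lt_top hfin hw'))
  filter_upwards [hW.ae_enorm_eq, hW.ne_zero] with t ht h0
  rw [enorm_mul, enorm_inv h0, ht, show (1 : CircleWeight).toFun t = 1 from rfl, mul_one]

/-- Multiplication by an outer function `W` with `|W| = w` maps `H[X(w)]` to `H[X]`. -/
noncomputable def IsOuter.mulMap (hW : IsOuter (fun t => (w.toFun t).toReal) W)
    (f : HardySpace ρ w) : HardySpace ρ 1 :=
  .ofFun _ (hW.isHOne_coeFn_mul f) (by
    rw [hW.toFun_mul]
    exact f.weightedENorm_ne_top.lt_top)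

/-- Division by an outer function `W` with `|W| = w` maps `H[X]` to `H[X(w)]`. -/
noncomputable def IsOuter.divMap (hW : IsOuter (fun t => (w.toFun t).toReal) W)
    (hw' : ρ.associate (fun t => (w.toFun t)⁻¹) < ∞) (g : HardySpace ρ 1) : HardySpace ρ w :=
  .ofFun _ (hW.isHOne_coeFn_mul_inv hw' g) (by
    rw [hW.toFun_mul_inv]
    exact g.weightedENorm_ne_top.lt_top)

theorem IsOuter.coeFn_mulMap (hW : IsOuter (fun t => (w.toFun t).toReal) W) (f : HardySpace ρ w) :
    (hW.mulMap f).toAEEqFun =ᵐ[circleMeasure] fun t => f.toAEEqFun t * W t :=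
  HardySpace.coeFn_ofFun _ _ _

theorem IsOuter.coeFn_divMap (hW : IsOuter (fun t => (w.toFun t).toReal) W)
    (hw' : ρ.associate (fun t => (w.toFun t)⁻¹) < ∞) (g : HardySpace ρ 1) :
    (hW.divMap hw' g).toAEEqFun =ᵐ[circleMeasure] fun t => g.toAEEqFun t * (W t)⁻¹ :=
  HardySpace.coeFn_ofFun _ _ _

/-- Multiplication by an outer function `W` with `|W| = w`, as an isometric isomorphism from
`H[X(w)]` onto `H[X]`. -/
noncomputable def IsOuter.isometryEquiv (hW : IsOuter (fun t => (w.toFun t).toReal) W)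
    (hw' : ρ.associate (fun t => (w.toFun t)⁻¹) < ∞) : HardySpace ρ w ≃ₗᵢ[ℂ] HardySpace ρ 1 where
  toFun := hW.mulMap
  invFun := hW.divMap hw'
  map_add' f g := by
    apply HardySpace.ext_ae
    filter_upwards [hW.coeFn_mulMap (f + g), hW.coeFn_mulMap f, hW.coeFn_mulMap g,
      HardySpace.coeFn_add f g, HardySpace.coeFn_add (hW.mulMap f) (hW.mulMap g)]
      with t h1 h2 h3 h4 h5
    rw [h1, h5, h2, h3, h4, add_mul]
  map_smul' c f := by
    apply HardySpace.ext_ae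
    filter_upwards [hW.coeFn_mulMap (c • f), hW.coeFn_mulMap f, HardySpace.coeFn_smul c f,
      HardySpace.coeFn_smul c (hW.mulMap f)] with t h1 h2 h3 h4
    rw [h1, RingHom.id_apply, h4, h2, h3, mul_assoc]
  left_inv f := by
    apply HardySpace.ext_ae
    filter_upwards [hW.coeFn_divMap hw' (hW.mulMap f), hW.coeFn_mulMap f, hW.ne_zero]
      with t h1 h2 h3
    rw [h1, h2, mul_inv_cancel_right₀ h3]
  right_inv g := by
    apply HardySpace.ext_ae
    filter_upwards [hW.coeFn_mulMap (hW.divMap hw' g), hW.coeFn_divMap hw' g, hW.ne_zero]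
      with t h1 h2 h3
    rw [h1, h2, inv_mul_cancel_right₀ h3]
  norm_map' f := by
    change ‖hW.mulMap f‖ = ‖f‖
    rw [HardySpace.norm_eq_of_ae_eq (hW.coeFn_mulMap f), hW.toFun_mul, HardySpace.norm_def]

end Isometry

/-! ### Compactness of the difference, and the theorem -/

/-- The functional `f ↦ (g f)^(k)` on `H[X(w)]`. -/
noncomputable def HardySpace.mulCoeff {ρ : BanachFunctionNorm} {w : CircleWeight}
    (g : UCircle → ℂ)
    (hg : ∀ f : HardySpace ρ w, Integrable (fun t => g t * f.toAEEqFun t) circleMeasure) (k : ℤ) :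
    HardySpace ρ w →ₗ[ℂ] ℂ where
  toFun f := fourierCoeff (fun t => g t * f.toAEEqFun t) k
  map_add' f₁ f₂ := fourierCoeff_mul_coeFn_add f₁ f₂ (hg f₁) (hg f₂) k
  map_smul' c f := fourierCoeff_mul_coeFn_smul c f k

theorem backwardShift_eq_of_fourierCoeff_eq_zero {n : ℕ} {g : UCircle → ℂ}
    (hg : ∀ k < n, fourierCoeff g (k : ℤ) = 0) (t : UCircle) :
    backwardShift n g t = g t * fourier (-n : ℤ) t := by
  rw [backwardShift, Finset.sum_eq_zero, sub_zero]
  intro k hk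
  rw [hg k (Finset.mem_range.1 hk), zero_mul]

theorem isCompactOperator_isometryConj_sub {ρ : BanachFunctionNorm} {w : CircleWeight}
    {W : UCircle → ℂ} (hW : IsOuter (fun t => (w.toFun t).toReal) W)
    (hw' : ρ.associate (fun t => (w.toFun t)⁻¹) < ∞) {n : ℕ} {h : UCircle → ℂ} (hh : MemHInfty h)
    {A : HardySpace ρ w →L[ℂ] HardySpace ρ w} {B : HardySpace ρ 1 →L[ℂ] HardySpace ρ 1}
    (hA : IsToeplitz (fun t => circlePt t ^ (-(n : ℤ)) * h t) A)
    (hB : IsToeplitz (fun t => circlePt t ^ (-(n : ℤ)) * h t) B) :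
    IsCompactOperator (isometryConj (hW.isometryEquiv hw').symm B - A :
      HardySpace ρ w →L[ℂ] HardySpace ρ w) := by
  set Φ := hW.isometryEquiv hw' with hΦ
  have hi1 : ∀ f : HardySpace ρ w, Integrable (fun t => h t * f.toAEEqFun t) circleMeasure :=
    fun f => (hh.isHOne_mul f.isHOne).1
  have hi2 : ∀ f : HardySpace ρ 1, Integrable (fun t => h t * f.toAEEqFun t) circleMeasure :=
    fun f => (hh.isHOne_mul f.isHOne).1
  -- These `2n` functionals are the coefficients that the two operators subtract from `h f` and `h W
  -- f`. On their common kernel nothing is subtracted, both operators multiply by `e₋ₙ h`, and `W`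
  -- cancels.
  let L : HardySpace ρ w →ₗ[ℂ] (Fin n → ℂ) × (Fin n → ℂ) :=
    (LinearMap.pi fun k : Fin n => HardySpace.mulCoeff h hi1 (k : ℕ)).prod
      (LinearMap.pi fun k : Fin n => (HardySpace.mulCoeff h hi2 (k : ℕ)).comp
        Φ.toLinearEquiv.toLinearMap)
  refine isCompactOperator_of_ker_le _ L fun f hf => ?_
  have hL : L f = 0 := hf
  have h1 : ∀ k < n, fourierCoeff (fun t => h t * f.toAEEqFun t) (k : ℤ) = 0 := fun k hk =>
    congr_fun (congr_arg Prod.fst hL) ⟨k, hk⟩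
  have h2 : ∀ k < n, fourierCoeff (fun t => h t * (Φ f).toAEEqFun t) (k : ℤ) = 0 := fun k hk =>
    congr_fun (congr_arg Prod.snd hL) ⟨k, hk⟩
  have hAB : Φ.symm (B (Φ f)) = A f := by
    apply HardySpace.ext_ae
    filter_upwards [hW.coeFn_divMap hw' (B (Φ f)), hW.coeFn_mulMap f,
      hB.coeFn_ae_eq hh (Φ f), hA.coeFn_ae_eq hh f, hW.ne_zero] with t e1 e2 e3 e4 e5
    change (hW.divMap hw' (B (Φ f))).toAEEqFun t = _
    change (Φ f).toAEEqFun t = _ at e2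
    rw [e1, e3, e4, backwardShift_eq_of_fourierCoeff_eq_zero h1,
      backwardShift_eq_of_fourierCoeff_eq_zero h2, e2]
    field_simp
  change isometryConj Φ.symm B f - A f = 0
  rw [isometryConj_apply, sub_eq_zero]
  exact hAB

theorem lemma3p3 (ρ : BanachFunctionNorm) (w : CircleWeight)
    (hw : ρ.toFun w.toFun < ∞) (hw' : ρ.associate (fun t => (w.toFun t)⁻¹) < ∞)
    (n : ℕ) (h : UCircle → ℂ) (hh : MemHInfty h) :
    (∃! A : HardySpace ρ w →L[ℂ] HardySpace ρ w,
      IsToeplitz (fun t => circlePt t ^ (-(n : ℤ)) * h t) A) ∧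
    (∃! B : HardySpace ρ 1 →L[ℂ] HardySpace ρ 1,
      IsToeplitz (fun t => circlePt t ^ (-(n : ℤ)) * h t) B) ∧
    ∀ (A : HardySpace ρ w →L[ℂ] HardySpace ρ w) (B : HardySpace ρ 1 →L[ℂ] HardySpace ρ 1),
      IsToeplitz (fun t => circlePt t ^ (-(n : ℤ)) * h t) A →
      IsToeplitz (fun t => circlePt t ^ (-(n : ℤ)) * h t) B →
      essentialNorm A = essentialNorm B := by
  refine ⟨?_, ?_, fun A B hA hB => ?_⟩
  · obtain ⟨A, hA⟩ := exists_isToeplitz hw hw' n hh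
    exact ⟨A, hA, fun A' hA' => hA'.unique hA⟩
  · obtain ⟨B, hB⟩ := exists_isToeplitz (w := 1) ρ.one_lt_top ρ.associate_one_lt_top n hh
    exact ⟨B, hB, fun B' hB' => hB'.unique hB⟩
  · obtain ⟨W, hW⟩ := CircleWeight.exists_isOuter hw hw'
    exact essentialNorm_eq_of_isCompactOperator (hW.isometryEquiv hw') A B
      (isCompactOperator_isometryConj_sub hW hw' hh hA hB)
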